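/- Let $\kappa\ge 1$ be an integer and let $\varphi_i(x)=A_ix+c_i$, $i\in\{1,\dots,\kappa\}$, be affine maps of $\mathbb{R}^2$ whose linear parts $A_i$ are invertible and contractive, that is, $\|A_i\|<1$ for the Euclidean operator norm. Let $E\subset\mathbb{R}^2$ be the associated self-affine set, that is, the unique nonempty compact set with $E=\bigcup_{i=1}^\kappa\varphi_i(E)$. No separation condition is assumed. For a finite word $\mathtt{i}=(i_1,\dots,i_n)$ put $A_{\mathtt{i}}=A_{i_1}\cdots A_{i_n}$, $\varphi_{\mathtt{i}}=\varphi_{i_1}\circ\cdots\circ\varphi_{i_n}$, $|\mathtt{i}|=n$. Let $\alpha_1(\mathtt{i})\ge\alpha_2(\mathtt{i})$ be the singular values of $A_{\mathtt{i}}$ and, if $\alpha_1(\mathtt{i})>\alpha_2(\mathtt{i})$, let $\vartheta_1(\mathtt{i})\in\mathbb{P}^1$ be the line through the origin spanned by the longer semiaxis of the ellipse $A_{\mathtt{i}}(B(0,1))$. Here $\mathbb{P}^1$ is the space of lines through the origin in $\mathbb{R}^2$, with the angle as distance, and $\langle e\rangle=\{te:t\in\mathbb{R}\}$ for $e\in S^1$.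 Assume dominated splitting: there are $\tau>1$ and $n_0\in\mathbb{N}$ with $\alpha_1(\mathtt{i})>\tau^{|\mathtt{i}|}\alpha_2(\mathtt{i})$ for all finite words $\mathtt{i}$ with $|\mathtt{i}|\ge n_0$. For an infinite word $\mathtt{i}\in\Sigma=\{1,\dots,\kappa\}^{\mathbb{N}}$ let $\vartheta_1(\mathtt{i})=\lim_{n\to\infty}\vartheta_1(\mathtt{i}|_n)$, where $\mathtt{i}|_n$ is the word of the first $n$ letters of $\mathtt{i}$ (the limit exists by domination), and write $\vartheta_1(\Sigma)=\{\vartheta_1(\mathtt{i}):\mathtt{i}\in\Sigma\}$. Assume also the projection condition: $\mathbb{P}^1\setminus\vartheta_1(\Sigma)\ne\emptyset$, and for every $e\in S^1$ with $\langle e\rangle\notin\vartheta_1(\Sigma)$ there is $n_0$ such that, for every finite word $\mathtt{i}$ with $|\mathtt{i}|\ge n_0$, the orthogonal projection of $\varphi_{\mathtt{i}}(E)$ along $e$ (onto the line orthogonal to $e$) is an interval with more than one point. For $e\in S^1$ let $\mathrm{vis}^e(E)=\{x\in\mathbb{R}^2 : \{x+te:t\ge0\}\cap E=\{x\}\}$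 be the visible part of $E$ in direction $e$. Then, for all $e\in S^1$ with $\langle e\rangle\notin\vartheta_1(\Sigma)$, $$\dim_H \mathrm{vis}^e(E)=\dim_A \mathrm{vis}^e(E)=1,$$ where $\dim_H$ is the Hausdorff dimension and $\dim_A$ the Assouad dimension. -/

import Mathlib

open Set Filter Topology
open scoped ENNReal NNReal LinearAlgebra.Projectivization RealInnerProductSpace

noncomputable section

namespace Visible

/-- The Euclidean plane. -/
abbrev Plane : Type := EuclideanSpace ℝ (Fin 2)

/-- A direction: an element of the unit circle. -/
abbrev Direction : Type := Metric.sphere (0 : Plane) 1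

/-- An orientation: a line through the origin. -/
abbrev Orientation : Type := ℙ ℝ Plane

/-- The orientation `⟨e⟩ = {t e : t ∈ ℝ}` of a direction. -/
def lineOf (e : Direction) : Orientation :=
  Projectivization.mk ℝ (e : Plane) (ne_zero_of_mem_unit_sphere e)

/-- The angle between two lines through the origin, the distance on the space of orientations:
the smaller one of the two angles between spanning vectors. -/
def lineAngle (p q : Orientation) : ℝ :=
  min (InnerProductGeometry.angle p.rep q.rep) (InnerProductGeometry.angle p.rep (-q.rep))

/-! ### Visible part and projections -/

/-- The half line `ℓ(e) = {t e : t ≥ 0}`, translated to start at `x`. -/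
def halfLine (x : Plane) (e : Direction) : Set Plane :=
  {y | ∃ t : ℝ, 0 ≤ t ∧ y = x + t • (e : Plane)}

/-- The visible part of `E` in direction `e`: the points `x` with `({x} + ℓ(e)) ∩ E = {x}`. -/
def vis (e : Direction) (E : Set Plane) : Set Plane :=
  {x | halfLine x e ∩ E = {x}}

/-- The orthogonal projection of the plane along the direction `e`, that is, onto the line
orthogonal to `e`. -/
def projAlong (e : Direction) (x : Plane) : Plane :=
  (ℝ ∙ (e : Plane))ᗮ.starProjection x

/-- A subset of a line is a non-trivial interval if it is convex and has more than one point. -/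
def IsNontrivialInterval (S : Set Plane) : Prop :=
  Collinear ℝ S ∧ Convex ℝ S ∧ S.Nontrivial

/-! ### Assouad dimension -/

/-- `F` satisfies the covering condition with exponent `s`: for some `C`, each set `F ∩ B(x, R)`
with `x ∈ F` can be covered by at most `C (R / r) ^ s` balls of radius `r`, for all
`0 < r < R`. -/
def AssouadExponent {X : Type*} [PseudoMetricSpace X] (F : Set X) (s : ℝ≥0) : Prop :=
  ∃ C : ℝ, 0 < C ∧ ∀ x ∈ F, ∀ r R : ℝ, 0 < r → r < R →
    ∃ t : Finset X, (t.card : ℝ) ≤ C * (R / r) ^ (s : ℝ) ∧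
      F ∩ Metric.closedBall x R ⊆ ⋃ y ∈ t, Metric.closedBall y r

/-- The Assouad dimension of a set: the infimum of all real `s ≥ 0` that satisfy the covering
condition. -/
def assouadDim {X : Type*} [PseudoMetricSpace X] (F : Set X) : ℝ≥0∞ :=
  ⨅ (s : ℝ≥0) (_ : AssouadExponent F s), (s : ℝ≥0∞)

/-! ### Singular values and major axes of an invertible linear map -/

/-- `α₁(A)`, the length of the longer semiaxis of `A(B(0,1))`. -/
def alpha₁ (A : Plane ≃L[ℝ] Plane) : ℝ :=
  (A.toLinearEquiv.toLinearMap).singularValues 0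

/-- `α₂(A)`, the length of the shorter semiaxis of `A(B(0,1))`. -/
def alpha₂ (A : Plane ≃L[ℝ] Plane) : ℝ :=
  (A.toLinearEquiv.toLinearMap).singularValues 1

/-- `η₁(A)`, a normalized eigenvector of `AᵀA` for its largest eigenvalue `α₁(A)²` (Mathlib's
`eigenvectorBasis` lists the eigenvalues in decreasing order). -/
def eta₁ (A : Plane ≃L[ℝ] Plane) : Plane :=
  (A.toLinearEquiv.toLinearMap).isSymmetric_adjoint_comp_self.eigenvectorBasis
    (finrank_euclideanSpace_fin (𝕜 := ℝ) (n := 2)) 0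

theorem norm_eta₁ (A : Plane ≃L[ℝ] Plane) : ‖eta₁ A‖ = 1 :=
  OrthonormalBasis.norm_eq_one _ _

theorem adjoint_comp_self_eta₁ (A : Plane ≃L[ℝ] Plane) :
    (LinearMap.adjoint A.toLinearEquiv.toLinearMap ∘ₗ A.toLinearEquiv.toLinearMap) (eta₁ A) =
      (alpha₁ A) ^ 2 • eta₁ A := by
  have h1 := LinearMap.sq_singularValues_fin A.toLinearEquiv.toLinearMap
    (finrank_euclideanSpace_fin (𝕜 := ℝ) (n := 2)) 0
  have h2 := LinearMap.IsSymmetric.apply_eigenvectorBasis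
    (A.toLinearEquiv.toLinearMap).isSymmetric_adjoint_comp_self
    (finrank_euclideanSpace_fin (𝕜 := ℝ) (n := 2)) 0
  rw [← h1] at h2
  exact h2

theorem map_eta₁_ne_zero (A : Plane ≃L[ℝ] Plane) : A (eta₁ A) ≠ 0 := by
  have h := norm_eta₁ A
  intro h0
  rw [(map_eq_zero_iff A A.injective).1 h0] at h
  simp at h

/-- `ϑ₁(A) = ⟨A η₁(A)⟩`, the orientation of the longer semiaxis of `A(B(0,1))`. It is independent
of the choice of `η₁(A)` when `α₁(A) > α₂(A)`, which is the only case of interest. -/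
def theta₁ (A : Plane ≃L[ℝ] Plane) : Orientation :=
  Projectivization.mk ℝ (A (eta₁ A)) (map_eta₁_ne_zero A)

/-! ### Affine iterated function systems -/

/-- A finite system of maps `φ_i(x) = A_i x + c_i` of the plane with contractive invertible linear
parts. -/
structure AffineIFS (κ : ℕ) where
  A : Fin κ → (Plane ≃L[ℝ] Plane)
  c : Fin κ → Plane
  contractive : ∀ i, ‖(A i : Plane →L[ℝ] Plane)‖ < 1

/-- The word of the first `n` letters of an infinite word. -/
def restrict {κ : ℕ} (i : ℕ → Fin κ) (n : ℕ) : List (Fin κ) :=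
  List.ofFn fun k : Fin n => i k

namespace AffineIFS

variable {κ : ℕ} (Φ : AffineIFS κ)

/-- `φ_i(x) = A_i x + c_i`. -/
def map (i : Fin κ) (x : Plane) : Plane := Φ.A i x + Φ.c i

/-- `A_w = A_{i₁} A_{i₂} ⋯ A_{iₙ}` for a finite word `w = (i₁, …, iₙ)`. -/
def wordLinear (w : List (Fin κ)) : Plane ≃L[ℝ] Plane := (w.map Φ.A).prod

/-- `φ_w = φ_{i₁} ∘ φ_{i₂} ∘ ⋯ ∘ φ_{iₙ}` for a finite word `w = (i₁, …, iₙ)`. -/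
def wordMap : List (Fin κ) → Plane → Plane
  | [] => id
  | i :: w => Φ.map i ∘ wordMap w

/-- `E` is the self-affine set of the system: the nonempty compact set with
`E = ⋃ i, φ_i(E)`. -/
def IsAttractor (E : Set Plane) : Prop :=
  IsCompact E ∧ E.Nonempty ∧ E = ⋃ i, Φ.map i '' E

/-- Dominated splitting: `α₁(w) > τ ^ |w| α₂(w)` for all sufficiently long words `w`, with a
constant `τ > 1`. -/
def Dominated : Prop :=
  ∃ τ : ℝ, 1 < τ ∧ ∃ n₀ : ℕ, ∀ w : List (Fin κ), n₀ ≤ w.length →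
    τ ^ w.length * alpha₂ (Φ.wordLinear w) < alpha₁ (Φ.wordLinear w)

/-- `L` is the limit orientation `ϑ₁(i) = lim ϑ₁(i|ₙ)` of the infinite word `i`. -/
def IsLimitOrientation (i : ℕ → Fin κ) (L : Orientation) : Prop :=
  Tendsto (fun n => lineAngle (theta₁ (Φ.wordLinear (restrict i n))) L) atTop (𝓝 0)

/-- The set `{ϑ₁(i) : i ∈ Σ}` of all limit orientations. -/
def limitOrientations : Set Orientation :=
  {L | ∃ i : ℕ → Fin κ, Φ.IsLimitOrientation i L}

/-- The projection condition for the system with invariant set `E`. -/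
def ProjectionCondition (E : Set Plane) : Prop :=
  Φ.limitOrientationsᶜ.Nonempty ∧
  ∀ e : Direction, lineOf e ∉ Φ.limitOrientations →
    ∃ n₀ : ℕ, ∀ w : List (Fin κ), n₀ ≤ w.length →
      IsNontrivialInterval (projAlong e '' (Φ.wordMap w '' E))

end AffineIFS

end Visible

end

namespace Visible

/-! ### The area form of the plane -/

/-- The signed area of the parallelogram spanned by two vectors. -/
def cross (x y : Plane) : ℝ := x 0 * y 1 - x 1 * y 0

theorem inner_eq (x y : Plane) : ⟪x, y⟫ = x 0 * y 0 + x 1 * y 1 := by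
  simp [PiLp.inner_apply, Fin.sum_univ_two]
  ring

theorem norm_sq_eq (x : Plane) : ‖x‖ ^ 2 = x 0 ^ 2 + x 1 ^ 2 := by
  simp [EuclideanSpace.norm_sq_eq, Fin.sum_univ_two]

theorem cross_sq_add_inner_sq (x y : Plane) :
    cross x y ^ 2 + ⟪x, y⟫ ^ 2 = ‖x‖ ^ 2 * ‖y‖ ^ 2 := by
  rw [norm_sq_eq, norm_sq_eq, inner_eq, cross]
  ring

theorem abs_cross_le (x y : Plane) : |cross x y| ≤ ‖x‖ * ‖y‖ := by
  apply abs_le_of_sq_le_sq _ (by positivity)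
  nlinarith [cross_sq_add_inner_sq x y, sq_nonneg ⟪x, y⟫]

theorem abs_inner_le (x y : Plane) : |⟪x, y⟫| ≤ ‖x‖ * ‖y‖ :=
  abs_real_inner_le_norm x y

theorem cross_comm (x y : Plane) : cross x y = -cross y x := by
  unfold cross; ring

theorem abs_cross_comm (x y : Plane) : |cross x y| = |cross y x| := by
  rw [cross_comm, abs_neg]

theorem cross_add (x y z : Plane) : cross x (y + z) = cross x y + cross x z := by
  simp only [cross, PiLp.add_apply]; ring

theorem cross_sub (x y z : Plane) : cross x (y - z) = cross x y - cross x z := by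
  simp only [cross, PiLp.sub_apply]; ring

theorem cross_smul (a : ℝ) (x y : Plane) : cross x (a • y) = a * cross x y := by
  simp only [cross, PiLp.smul_apply, smul_eq_mul]; ring

theorem smul_cross (a : ℝ) (x y : Plane) : cross (a • x) y = a * cross x y := by
  simp only [cross, PiLp.smul_apply, smul_eq_mul]; ring

theorem cross_self (x : Plane) : cross x x = 0 := by
  unfold cross; ring

/-- `cross x` as a linear form. -/
def crossₗ (x : Plane) : Plane →ₗ[ℝ] ℝ where
  toFun := cross x
  map_add' := cross_add x
  map_smul' a y := cross_smul a x y

/-- Triangle inequality for the sine of the angle between lines. -/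
theorem abs_cross_mul_sq_le (x y z : Plane) :
    |cross x z| * ‖y‖ ^ 2 ≤ |cross x y| * (‖y‖ * ‖z‖) + (‖x‖ * ‖y‖) * |cross y z| := by
  have h : cross x z * ‖y‖ ^ 2 = cross x y * ⟪y, z⟫ + ⟪x, y⟫ * cross y z := by
    rw [norm_sq_eq, inner_eq, inner_eq]; unfold cross; ring
  have h' : |cross x z| * ‖y‖ ^ 2 = |cross x z * ‖y‖ ^ 2| := by
    rw [abs_mul, abs_of_nonneg (sq_nonneg ‖y‖)]
  rw [h', h]
  refine (abs_add_le _ _).trans ?_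
  rw [abs_mul, abs_mul]
  gcongr
  · exact abs_inner_le y z
  · exact abs_inner_le x y

/-- The sine of the angle between the lines spanned by two vectors. -/
noncomputable def sinAngle (x y : Plane) : ℝ := |cross x y| / (‖x‖ * ‖y‖)

theorem sinAngle_triangle (x z : Plane) {y : Plane} (hy : y ≠ 0) :
    sinAngle x z ≤ sinAngle x y + sinAngle y z := by
  unfold sinAngle
  rcases eq_or_ne x 0 with rfl | hx
  · simp; positivity
  rcases eq_or_ne z 0 with rfl | hz
  · simp; positivity
  have hx' := norm_pos_iff.2 hx
  have hy' := norm_pos_iff.2 hy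
  have hz' := norm_pos_iff.2 hz
  have h := abs_cross_mul_sq_le x y z
  rw [div_add_div _ _ (by positivity) (by positivity), div_le_div_iff₀ (by positivity)
    (by positivity)]
  have := mul_le_mul_of_nonneg_right h (show 0 ≤ ‖x‖ * ‖z‖ by positivity)
  nlinarith [this]

theorem sinAngle_comm (x y : Plane) : sinAngle x y = sinAngle y x := by
  unfold sinAngle
  rw [abs_cross_comm, mul_comm ‖x‖]

theorem sinAngle_self (x : Plane) : sinAngle x x = 0 := by
  simp [sinAngle, cross_self]

theorem sinAngle_nonneg (x y : Plane) : 0 ≤ sinAngle x y := by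
  unfold sinAngle; positivity

theorem sinAngle_smul {a : ℝ} (ha : a ≠ 0) (x y : Plane) : sinAngle (a • x) y = sinAngle x y := by
  unfold sinAngle
  rw [smul_cross, abs_mul, norm_smul, Real.norm_eq_abs, mul_assoc,
    mul_div_mul_left _ _ (abs_ne_zero.2 ha)]

theorem lineAngle_nonneg (p q : Orientation) : 0 ≤ lineAngle p q :=
  le_min (InnerProductGeometry.angle_nonneg _ _) (InnerProductGeometry.angle_nonneg _ _)

theorem min_angle_le {x y : Plane} (hx : x ≠ 0) (hy : y ≠ 0) :
    min (InnerProductGeometry.angle x y) (InnerProductGeometry.angle x (-y)) ≤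
      Real.pi / 2 * sinAngle x y := by
  rw [InnerProductGeometry.angle_neg_right]
  set t := InnerProductGeometry.angle x y with ht
  have h0 := InnerProductGeometry.angle_nonneg x y
  have h1 := InnerProductGeometry.angle_le_pi x y
  have hsin : Real.sin t = sinAngle x y := by
    have hs : 0 ≤ Real.sin t := InnerProductGeometry.sin_angle_nonneg x y
    have hx' := norm_pos_iff.2 hx
    have hy' := norm_pos_iff.2 hy
    rw [← sq_eq_sq₀ hs (sinAngle_nonneg x y), Real.sin_sq, ht, InnerProductGeometry.cos_angle,
      sinAngle, div_pow, div_pow, sq_abs, eq_div_iff (by positivity), sub_mul,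
      div_mul_cancel₀ _ (by positivity)]
    linarith [cross_sq_add_inner_sq x y, mul_pow ‖x‖ ‖y‖ 2]
  have key : min t (Real.pi - t) ≤ Real.pi / 2 * Real.sin t := by
    have hpi := Real.pi_pos
    rcases le_total t (Real.pi / 2) with h | h
    · refine (min_le_left _ _).trans ?_
      have := Real.mul_le_sin h0 h
      calc t = Real.pi / 2 * (2 / Real.pi * t) := by field_simp
        _ ≤ _ := by gcongr
    · refine (min_le_right _ _).trans ?_
      have := Real.mul_le_sin (x := Real.pi - t) (by linarith) (by linarith)
      rw [Real.sin_pi_sub] at this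
      calc Real.pi - t = Real.pi / 2 * (2 / Real.pi * (Real.pi - t)) := by field_simp
        _ ≤ _ := by gcongr
  rwa [hsin] at key

theorem lineAngle_mk_le {x y : Plane} (hx : x ≠ 0) (hy : y ≠ 0) :
    lineAngle (Projectivization.mk ℝ x hx) (Projectivization.mk ℝ y hy) ≤
      Real.pi / 2 * sinAngle x y := by
  obtain ⟨a, ha⟩ := Projectivization.exists_smul_eq_mk_rep ℝ x hx
  obtain ⟨b, hb⟩ := Projectivization.exists_smul_eq_mk_rep ℝ y hy
  refine (min_angle_le (Projectivization.rep_nonzero _) (Projectivization.rep_nonzero _)).trans ?_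
  rw [← ha, ← hb, Units.smul_def, Units.smul_def, sinAngle_smul a.ne_zero, sinAngle_comm,
    sinAngle_smul b.ne_zero, sinAngle_comm]

/-! ### Singular values of planar maps -/

/-- The orthonormal basis of right singular vectors. -/
noncomputable def singularBasis (A : Plane ≃L[ℝ] Plane) : OrthonormalBasis (Fin 2) ℝ Plane :=
  (A.toLinearEquiv.toLinearMap).isSymmetric_adjoint_comp_self.eigenvectorBasis
    (finrank_euclideanSpace_fin (𝕜 := ℝ) (n := 2))

theorem adjoint_comp_self_singularBasis (A : Plane ≃L[ℝ] Plane) (i : Fin 2) :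
    (LinearMap.adjoint A.toLinearEquiv.toLinearMap ∘ₗ A.toLinearEquiv.toLinearMap)
      (singularBasis A i) =
      ((A.toLinearEquiv.toLinearMap).singularValues i) ^ 2 • singularBasis A i := by
  have h1 := LinearMap.sq_singularValues_fin A.toLinearEquiv.toLinearMap
    (finrank_euclideanSpace_fin (𝕜 := ℝ) (n := 2)) i
  have h2 := LinearMap.IsSymmetric.apply_eigenvectorBasis
    (A.toLinearEquiv.toLinearMap).isSymmetric_adjoint_comp_self
    (finrank_euclideanSpace_fin (𝕜 := ℝ) (n := 2)) i
  rw [← h1] at h2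
  exact h2

theorem inner_map_singularBasis (A : Plane ≃L[ℝ] Plane) (i j : Fin 2) :
    ⟪A (singularBasis A i), A (singularBasis A j)⟫ =
      ((A.toLinearEquiv.toLinearMap).singularValues i) ^ 2 * if i = j then 1 else 0 := by
  have h := adjoint_comp_self_singularBasis A i
  have h2 := LinearMap.adjoint_inner_left A.toLinearEquiv.toLinearMap (singularBasis A j)
    (A (singularBasis A i))
  have h3 : (LinearMap.adjoint A.toLinearEquiv.toLinearMap) (A (singularBasis A i)) =
    ((A.toLinearEquiv.toLinearMap).singularValues i) ^ 2 • singularBasis A i := h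
  rw [h3, real_inner_smul_left, orthonormal_iff_ite.1 (singularBasis A).orthonormal i j] at h2
  exact h2.symm

theorem alpha₁_nonneg (A : Plane ≃L[ℝ] Plane) : 0 ≤ alpha₁ A :=
  LinearMap.singularValues_nonneg _ _

theorem alpha₂_nonneg (A : Plane ≃L[ℝ] Plane) : 0 ≤ alpha₂ A :=
  LinearMap.singularValues_nonneg _ _

theorem alpha₂_le_alpha₁ (A : Plane ≃L[ℝ] Plane) : alpha₂ A ≤ alpha₁ A :=
  LinearMap.singularValues_antitone _ (Nat.zero_le 1)

theorem norm_map_eta₁ (A : Plane ≃L[ℝ] Plane) : ‖A (eta₁ A)‖ = alpha₁ A := by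
  have h := inner_map_singularBasis A 0 0
  rw [real_inner_self_eq_norm_sq] at h
  rw [← sq_eq_sq₀ (norm_nonneg _) (alpha₁_nonneg A)]
  rw [if_pos rfl, mul_one] at h
  exact h

theorem norm_map_le (A : Plane ≃L[ℝ] Plane) (x : Plane) : ‖A x‖ ≤ alpha₁ A * ‖x‖ := by
  have hsum := (singularBasis A).sum_repr x
  rw [Fin.sum_univ_two] at hsum
  set a := (singularBasis A).repr x 0
  set b := (singularBasis A).repr x 1
  have h00 := inner_map_singularBasis A 0 0
  have h01 := inner_map_singularBasis A 0 1
  have h11 := inner_map_singularBasis A 1 1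
  have g (i j : Fin 2) := orthonormal_iff_ite.1 (singularBasis A).orthonormal i j
  have g00 := g 0 0
  have g01 := g 0 1
  have g11 := g 1 1
  simp only [if_true, mul_one, Fin.isValue, zero_ne_one, if_false, mul_zero,
    real_inner_self_eq_norm_sq] at h00 h01 h11 g00 g01 g11
  have hA : ‖A x‖ ^ 2 = a ^ 2 * alpha₁ A ^ 2 + b ^ 2 * alpha₂ A ^ 2 := by
    rw [← hsum, map_add, map_smul, map_smul, norm_add_sq_real, norm_smul, norm_smul,
      real_inner_smul_left, real_inner_smul_right, mul_pow, mul_pow, h00, h01, h11]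
    simp [alpha₁, alpha₂]
  have hx : ‖x‖ ^ 2 = a ^ 2 + b ^ 2 := by
    rw [← hsum, norm_add_sq_real, norm_smul, norm_smul,
      real_inner_smul_left, real_inner_smul_right, mul_pow, mul_pow, g00, g01, g11]
    simp
  have hle : alpha₂ A ^ 2 ≤ alpha₁ A ^ 2 :=
    pow_le_pow_left₀ (alpha₂_nonneg A) (alpha₂_le_alpha₁ A) 2
  apply (sq_le_sq₀ (norm_nonneg _) (mul_nonneg (alpha₁_nonneg A) (norm_nonneg x))).1
  rw [mul_pow, hA, hx]
  nlinarith [mul_le_mul_of_nonneg_left hle (sq_nonneg b)]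

theorem norm_eq_alpha₁ (A : Plane ≃L[ℝ] Plane) : ‖(A : Plane →L[ℝ] Plane)‖ = alpha₁ A := by
  apply le_antisymm
  · exact ContinuousLinearMap.opNorm_le_bound _ (alpha₁_nonneg A) (norm_map_le A)
  · have := (A : Plane →L[ℝ] Plane).le_opNorm (eta₁ A)
    rw [norm_eta₁, mul_one] at this
    rw [← norm_map_eta₁]
    exact this

theorem cross_map (A : Plane ≃L[ℝ] Plane) (x y : Plane) :
    cross (A x) (A y) =
      cross (A (EuclideanSpace.single 0 1)) (A (EuclideanSpace.single 1 1)) * cross x y := by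
  have h (x : Plane) : x = x 0 • EuclideanSpace.single (0 : Fin 2) (1 : ℝ) +
      x 1 • EuclideanSpace.single (1 : Fin 2) (1 : ℝ) := by
    ext i; fin_cases i <;> simp
  conv_lhs => rw [h x, h y]
  simp only [map_add, map_smul, cross, PiLp.add_apply, PiLp.smul_apply, smul_eq_mul]
  ring

theorem abs_cross_map (A : Plane ≃L[ℝ] Plane) (x y : Plane) :
    |cross (A x) (A y)| = alpha₁ A * alpha₂ A * |cross x y| := by
  have h0 := cross_map A (singularBasis A 0) (singularBasis A 1)
  have h00 := inner_map_singularBasis A 0 0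
  have h01 := inner_map_singularBasis A 0 1
  have h11 := inner_map_singularBasis A 1 1
  have g (i j : Fin 2) := orthonormal_iff_ite.1 (singularBasis A).orthonormal i j
  have g00 := g 0 0
  have g01 := g 0 1
  have g11 := g 1 1
  simp only [if_true, mul_one, Fin.isValue, zero_ne_one, if_false, mul_zero,
    real_inner_self_eq_norm_sq] at h00 h01 h11 g00 g01 g11
  have e1 := cross_sq_add_inner_sq (singularBasis A 0) (singularBasis A 1)
  have e2 := cross_sq_add_inner_sq (A (singularBasis A 0)) (A (singularBasis A 1))
  rw [g00, g01, g11] at e1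
  rw [h00, h01, h11] at e2
  rw [cross_map, abs_mul]
  congr 1
  rw [← sq_eq_sq₀ (abs_nonneg _) (mul_nonneg (alpha₁_nonneg A) (alpha₂_nonneg A)), sq_abs, mul_pow]
  rw [zero_pow two_ne_zero, add_zero] at e2
  have e3 : cross (A (singularBasis A 0)) (A (singularBasis A 1)) ^ 2 =
    alpha₁ A ^ 2 * alpha₂ A ^ 2 := e2
  rw [← e3, h0, mul_pow]
  have : cross (singularBasis A 0) (singularBasis A 1) ^ 2 = 1 := by linarith
  rw [this, mul_one]

/-! ### Box counting for graphs without thin peaks -/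

/-- Refining a sequence so that the new values exceed the old ones, but exceed neighbouring old
values by at most `ρ`, increases the total variation only in a controlled way. -/
theorem variation_refine_le {a b : ℕ → ℝ} {ρ : ℝ} (hl : ∀ j, a j ≤ b (2 * j))
    (hr : ∀ j, a j ≤ b (2 * j + 1)) (hl' : ∀ j, b (2 * j + 2) ≤ max (a j) (a (j + 1)) + ρ)
    (hr' : ∀ j, b (2 * j + 1) ≤ max (a j) (a (j + 1)) + ρ) (n : ℕ) :
    ∑ i ∈ Finset.range (2 * n + 1), |b (i + 1) - b i| ≤
      ∑ j ∈ Finset.range n, |a (j + 1) - a j| + 2 * n * ρ + (b 0 - a 0) +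
        (b (2 * n + 1) - a n) := by
  induction n with
  | zero =>
    have h0 := hl 0
    have h1 := hr 0
    simp only [mul_zero, zero_add, Finset.range_one, Finset.sum_singleton, Finset.range_zero,
      Finset.sum_empty, Nat.cast_zero, zero_mul] at *
    rw [abs_le]
    constructor <;> linarith
  | succ n ih =>
    rw [show 2 * (n + 1) + 1 = 2 * n + 1 + 1 + 1 by ring, Finset.sum_range_succ,
      Finset.sum_range_succ, Finset.sum_range_succ _ n]
    have h1 := hr n
    have h2 := hl (n + 1)
    have h3 := hr (n + 1)
    have h4 := hl' n
    have h5 := hr' n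
    rw [show 2 * (n + 1) = 2 * n + 2 by ring] at h2 h3
    rw [show 2 * n + 1 + 1 + 1 = 2 * n + 3 by ring, show 2 * n + 1 + 1 = 2 * n + 2 by ring]
    rw [show 2 * n + 2 + 1 = 2 * n + 3 by ring] at h3
    push_cast
    have h6 : |b (2 * n + 3) - b (2 * n + 2)| ≤
        (b (2 * n + 3) - a (n + 1)) + (b (2 * n + 2) - a (n + 1)) := by
      rw [abs_le]
      constructor <;> linarith
    have h7 : |b (2 * n + 2) - b (2 * n + 1)| + (b (2 * n + 2) - a (n + 1)) +
        (b (2 * n + 1) - a n) ≤ |a (n + 1) - a n| + 2 * ρ := by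
      rcases le_total (a n) (a (n + 1)) with h | h
      · rw [max_eq_right h] at h4 h5
        rw [abs_of_nonneg (sub_nonneg.2 h)]
        rcases abs_cases (b (2 * n + 2) - b (2 * n + 1)) with ⟨h8, _⟩ | ⟨h8, _⟩ <;>
        rw [h8] <;> linarith
      · rw [max_eq_left h] at h4 h5
        rw [abs_of_nonpos (sub_nonpos.2 h)]
        rcases abs_cases (b (2 * n + 2) - b (2 * n + 1)) with ⟨h8, _⟩ | ⟨h8, _⟩ <;>
        rw [h8] <;> linarith
    linarith

/-- Each point of the graph of `g` lies, up to an error `ρ` in height, below the graph over an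
interval of length `δ ρ` which starts or ends at it. -/
def NoThinPeaks (δ : ℝ) (g : ℝ → ℝ) : Prop :=
  ∀ t ρ : ℝ, 0 < ρ → (∀ s ∈ Icc (t - δ * ρ) t, g t - ρ ≤ g s) ∨
    (∀ s ∈ Icc t (t + δ * ρ), g t - ρ ≤ g s)

/-- The `j`-th interval of length `w` to the right of `a`. -/
def cell (a w : ℝ) (j : ℕ) : Set ℝ := Icc (a + j * w) (a + (j + 1) * w)

/-- The infimum of `g` over a cell. -/
noncomputable def cellInf (g : ℝ → ℝ) (a w : ℝ) (j : ℕ) : ℝ := sInf (g '' cell a w j)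

section

variable {g : ℝ → ℝ} {a w δ ρ H : ℝ}

theorem cellInf_le (hg : ∀ t, 0 ≤ g t) {j : ℕ} {t : ℝ} (ht : t ∈ cell a w j) :
    cellInf g a w j ≤ g t :=
  csInf_le ⟨0, by rintro _ ⟨s, -, rfl⟩; exact hg s⟩ (mem_image_of_mem g ht)

theorem left_mem_cell (hw : 0 ≤ w) (j : ℕ) : a + j * w ∈ cell a w j :=
  ⟨le_rfl, by linarith⟩

theorem right_mem_cell (hw : 0 ≤ w) (j : ℕ) : a + (j + 1) * w ∈ cell a w j :=
  ⟨by linarith, le_rfl⟩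

theorem le_cellInf (hw : 0 ≤ w) {j : ℕ} {c : ℝ} (h : ∀ t ∈ cell a w j, c ≤ g t) :
    c ≤ cellInf g a w j :=
  le_csInf ⟨_, mem_image_of_mem g (left_mem_cell hw j)⟩ (by rintro _ ⟨s, hs, rfl⟩; exact h s hs)

theorem cellInf_nonneg (hw : 0 ≤ w) (hg : ∀ t, 0 ≤ g t) (j : ℕ) : 0 ≤ cellInf g a w j :=
  le_cellInf hw fun t _ => hg t

theorem cellInf_le_of_le (hw : 0 ≤ w) (hg : ∀ t, 0 ≤ g t) (hH : ∀ t, g t ≤ H) (j : ℕ) :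
    cellInf g a w j ≤ H :=
  (cellInf_le hg (left_mem_cell hw j)).trans (hH _)

theorem cellInf_le_cellInf (hg : ∀ t, 0 ≤ g t) {w' : ℝ} {i j : ℕ} (hw' : 0 ≤ w')
    (h : cell a w' i ⊆ cell a w j) : cellInf g a w j ≤ cellInf g a w' i :=
  le_cellInf hw' fun _ ht => cellInf_le hg (h ht)

theorem le_max_cellInf (hw : 0 ≤ w) (hthin : NoThinPeaks δ g) (hρ : 0 < ρ) (hδ : w ≤ δ * ρ)
    (j : ℕ) : g (a + (j + 1) * w) ≤ max (cellInf g a w j) (cellInf g a w (j + 1)) + ρ := by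
  rcases hthin (a + (j + 1) * w) ρ hρ with h | h
  · have : g (a + (j + 1) * w) - ρ ≤ cellInf g a w j :=
      le_cellInf hw fun s hs => h s ⟨by have := hs.1; linarith, hs.2⟩
    linarith [le_max_left (cellInf g a w j) (cellInf g a w (j + 1))]
  · have : g (a + (j + 1) * w) - ρ ≤ cellInf g a w (j + 1) :=
      le_cellInf hw fun s hs => h s ⟨by have := hs.1; push_cast at this; linarith,
        by have := hs.2; push_cast at this; linarith⟩
    linarith [le_max_right (cellInf g a w j) (cellInf g a w (j + 1))]

/-- The total variation of the cell infima grows at most linearly in the number of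
subdivisions. -/
theorem variation_cellInf_le (hg : ∀ t, 0 ≤ g t) (hH : ∀ t, g t ≤ H) (hδ : 0 < δ)
    (hthin : NoThinPeaks δ g) {W : ℝ} (hW : 0 < W) (k : ℕ) :
    ∑ j ∈ Finset.range (2 ^ k - 1),
      |cellInf g a (W / 2 ^ k) (j + 1) - cellInf g a (W / 2 ^ k) j| ≤
      k * (2 * W / δ + 2 * H) := by
  induction k with
  | zero => simp
  | succ k ih =>
    set w := W / 2 ^ k with hwdef
    have hw : 0 < w := by positivity
    have hw2 : W / 2 ^ (k + 1) = w / 2 := by rw [hwdef, pow_succ]; field_simp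
    rw [hw2]
    have hpos : 0 < 2 ^ k := by positivity
    have hn : 2 ^ (k + 1) - 1 = 2 * (2 ^ k - 1) + 1 := by
      rw [pow_succ]; omega
    rw [hn]
    have hw2' : 0 ≤ w / 2 := by positivity
    have hρ : 0 < w / δ := by positivity
    have hmax := fun j => le_max_cellInf (a := a) hw.le hthin hρ (mul_div_cancel₀ w hδ.ne').ge j
    have key := variation_refine_le (a := cellInf g a w) (b := cellInf g a (w / 2)) (ρ := w / δ)
      (fun j => cellInf_le_cellInf hg hw2' (Icc_subset_Icc (by push_cast; linarith)
        (by push_cast; linarith)))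
      (fun j => cellInf_le_cellInf hg hw2' (Icc_subset_Icc (by push_cast; linarith)
        (by push_cast; linarith)))
      (fun j => (cellInf_le hg (by
        convert left_mem_cell hw2' (2 * j + 2) using 1; push_cast; ring)).trans (hmax j))
      (fun j => (cellInf_le hg (by
        convert right_mem_cell hw2' (2 * j + 1) using 1; push_cast; ring)).trans (hmax j))
      (2 ^ k - 1)
    refine key.trans ?_
    have h1 := cellInf_nonneg (a := a) hw.le hg 0
    have h2 := cellInf_nonneg (a := a) hw.le hg (2 ^ k - 1)
    have h3 := cellInf_le_of_le (a := a) hw2' hg hH 0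
    have h4 := cellInf_le_of_le (a := a) hw2' hg hH (2 * (2 ^ k - 1) + 1)
    have h5 : 2 * ((2 ^ k - 1 : ℕ) : ℝ) * (w / δ) ≤ 2 * W / δ := by
      have : ((2 ^ k - 1 : ℕ) : ℝ) ≤ 2 ^ k := by
        exact_mod_cast Nat.sub_le _ _
      calc 2 * ((2 ^ k - 1 : ℕ) : ℝ) * (w / δ) ≤ 2 * 2 ^ k * (w / δ) := by gcongr
        _ = 2 * W / δ := by rw [hwdef]; field_simp
    push_cast
    linarith

theorem le_cellInf_neighbour (hw : 0 ≤ w) (hthin : NoThinPeaks δ g) (hρ : 0 < ρ)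
    (hδ : 2 * w ≤ δ * ρ) {j : ℕ} {t : ℝ} (ht : t ∈ cell a w (j + 1)) :
    g t - ρ ≤ cellInf g a w j ∨ g t - ρ ≤ cellInf g a w (j + 2) := by
  have h1 := ht.1
  have h2 := ht.2
  push_cast at h1 h2
  rcases hthin t ρ hρ with h | h
  · refine Or.inl (le_cellInf hw fun s hs => h s ⟨?_, ?_⟩)
    · linarith [hs.1]
    · linarith [hs.2]
  · refine Or.inr (le_cellInf hw fun s hs => h s ⟨?_, ?_⟩)
    · have := hs.1; push_cast at this; linarith
    · have := hs.2; push_cast at this; linarith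

/-- The graph of a function without thin peaks over an interval of length `W` is covered by few
boxes of width `W / 2 ^ k` and height `r`. -/
theorem exists_box_cover (hg : ∀ t, 0 ≤ g t) (hH : ∀ t, g t ≤ H) (hδ : 0 < δ)
    (hthin : NoThinPeaks δ g) {W r : ℝ} (hW : 0 < W) (hr : 0 < r) (k : ℕ) :
    ∃ P : Finset (ℝ × ℝ), (P.card : ℝ) ≤ 2 ^ k + (2 * k + 1) * (2 * W / δ + 2 * H) / r ∧
      ∀ t ∈ Icc a (a + W), ∃ p ∈ P, |t - p.1| ≤ W / 2 ^ k ∧ |g t - p.2| ≤ r := by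
  classical
  set w := W / 2 ^ k with hwdef
  have hw : 0 < w := by positivity
  obtain ⟨n, hn⟩ : ∃ n, 2 ^ k = n + 1 := ⟨2 ^ k - 1, (Nat.sub_add_cancel Nat.one_le_two_pow).symm⟩
  have hV := variation_cellInf_le (a := a) hg hH hδ hthin hW k
  rw [hn, Nat.add_sub_cancel, ← hwdef] at hV
  have hH0 : 0 ≤ H := (hg 0).trans (hH 0)
  set m := cellInf g a w with hm
  let L : ℕ → ℝ := fun j => Nat.casesOn j H fun i => |m (i + 1) - m i|
  let R : ℕ → ℝ := fun j => if j < n then |m (j + 1) - m j| else H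
  let U : ℕ → ℝ := fun j => L j + R j + 2 * w / δ
  have hL0 (j : ℕ) : 0 ≤ L j := by cases j <;> simp [L, hH0]
  have hR0 (j : ℕ) : 0 ≤ R j := by simp only [R]; split_ifs <;> positivity
  have hρ : 0 < 2 * w / δ := by positivity
  have hU0 (j : ℕ) : 0 ≤ U j := add_nonneg (add_nonneg (hL0 j) (hR0 j)) hρ.le
  have hU (j : ℕ) (hj : j < n + 1) (t : ℝ) (ht : t ∈ cell a w j) : g t ≤ m j + U j := by
    have hmj : 0 ≤ m j := cellInf_nonneg hw.le hg j
    rcases j with _ | j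
    · have : L 0 = H := rfl
      simp only [U]
      linarith [hH t, hR0 0]
    by_cases hjn : j + 1 < n
    · have hLj : L (j + 1) = |m (j + 1) - m j| := rfl
      have hRj : R (j + 1) = |m (j + 2) - m (j + 1)| := if_pos hjn
      simp only [U, hLj, hRj]
      have h1 := neg_abs_le (m (j + 1) - m j)
      have h2 := le_abs_self (m (j + 2) - m (j + 1))
      have h3 := abs_nonneg (m (j + 1) - m j)
      have h4 := abs_nonneg (m (j + 2) - m (j + 1))
      rcases le_cellInf_neighbour hw.le hthin hρ (mul_div_cancel₀ (2 * w) hδ.ne').ge ht with h | h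
      · have h' : g t - 2 * w / δ ≤ m j := h
        linarith
      · have h' : g t - 2 * w / δ ≤ m (j + 2) := h
        linarith
    · have hRj : R (j + 1) = H := if_neg hjn
      simp only [U, hRj]
      linarith [hH t, hL0 (j + 1)]
  have hsum : ∑ j ∈ Finset.range (n + 1), U j ≤ (2 * k + 1) * (2 * W / δ + 2 * H) := by
    have e1 : ∑ j ∈ Finset.range (n + 1), L j = ∑ j ∈ Finset.range n, |m (j + 1) - m j| + H := by
      rw [Finset.sum_range_succ']
      rfl
    have e2 : ∑ j ∈ Finset.range (n + 1), R j = ∑ j ∈ Finset.range n, |m (j + 1) - m j| + H := by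
      rw [Finset.sum_range_succ]
      congr 1
      · exact Finset.sum_congr rfl fun j hj => if_pos (Finset.mem_range.1 hj)
      · exact if_neg (lt_irrefl n)
    have e3 : ∑ j ∈ Finset.range (n + 1), (2 * w / δ) = 2 * W / δ := by
      rw [Finset.sum_const, Finset.card_range, ← hn, nsmul_eq_mul, hwdef]
      push_cast
      field_simp
    simp only [U, Finset.sum_add_distrib]
    rw [e1, e2, e3]
    linarith
  let P : Finset (ℝ × ℝ) := (Finset.range (n + 1)).biUnion fun j =>
    (Finset.range (⌊U j / r⌋₊ + 1)).image fun i : ℕ => (a + j * w, m j + i * r)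
  refine ⟨P, ?_, ?_⟩
  · have h1 : P.card ≤ ∑ j ∈ Finset.range (n + 1), (⌊U j / r⌋₊ + 1) :=
      Finset.card_biUnion_le.trans (Finset.sum_le_sum fun j _ =>
        Finset.card_image_le.trans (Finset.card_range _).le)
    calc (P.card : ℝ) ≤ ((∑ j ∈ Finset.range (n + 1), (⌊U j / r⌋₊ + 1) : ℕ) : ℝ) := by
          exact_mod_cast h1
      _ = ∑ j ∈ Finset.range (n + 1), ((⌊U j / r⌋₊ : ℝ) + 1) := by push_cast; rfl
      _ ≤ ∑ j ∈ Finset.range (n + 1), (U j / r + 1) := by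
          gcongr with j _
          exact Nat.floor_le (div_nonneg (hU0 j) hr.le)
      _ = (∑ j ∈ Finset.range (n + 1), U j) / r + 2 ^ k := by
          rw [Finset.sum_add_distrib, Finset.sum_div, Finset.sum_const, Finset.card_range, ← hn]
          simp
      _ ≤ (2 * k + 1) * (2 * W / δ + 2 * H) / r + 2 ^ k := by gcongr
      _ = _ := add_comm _ _
  · intro t ht
    have hNW : ((n : ℝ) + 1) * w = W := by
      have : ((n : ℝ) + 1) = 2 ^ k := by exact_mod_cast hn.symm
      rw [this, hwdef]; field_simp
    obtain ⟨j, hj, htj⟩ : ∃ j < n + 1, t ∈ cell a w j := by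
      have hs0 : 0 ≤ (t - a) / w := div_nonneg (by linarith [ht.1]) hw.le
      have hs1 : (t - a) / w ≤ n + 1 := by rw [div_le_iff₀ hw]; linarith [ht.2]
      have hsw : (t - a) / w * w = t - a := div_mul_cancel₀ _ hw.ne'
      by_cases hlt : ⌊(t - a) / w⌋₊ < n + 1
      · refine ⟨_, hlt, ?_, ?_⟩
        · nlinarith [Nat.floor_le hs0]
        · nlinarith [Nat.lt_floor_add_one ((t - a) / w)]
      · have h1 : ((n + 1 : ℕ) : ℝ) ≤ (t - a) / w := (Nat.le_floor_iff hs0).1 (not_lt.1 hlt)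
        push_cast at h1
        have h2 : t - a = (n + 1) * w := by rw [← hsw, le_antisymm hs1 h1]
        refine ⟨n, Nat.lt_succ_self n, ?_, ?_⟩ <;> linarith
    have hlow : m j ≤ g t := cellInf_le hg htj
    have hup := hU j hj t htj
    have hq0 : 0 ≤ (g t - m j) / r := div_nonneg (by linarith) hr.le
    have hqr : (g t - m j) / r * r = g t - m j := div_mul_cancel₀ _ hr.ne'
    refine ⟨(a + j * w, m j + ⌊(g t - m j) / r⌋₊ * r), ?_, ?_, ?_⟩
    · refine Finset.mem_biUnion.2 ⟨j, Finset.mem_range.2 hj, Finset.mem_image.2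
        ⟨⌊(g t - m j) / r⌋₊, Finset.mem_range.2 (Nat.lt_succ_of_le (Nat.floor_mono ?_)), rfl⟩⟩
      gcongr
      linarith
    · rw [abs_le]
      constructor <;> simp only <;> linarith [htj.1, htj.2]
    · rw [abs_le]
      constructor <;> simp only <;>
        nlinarith [Nat.floor_le hq0, Nat.lt_floor_add_one ((g t - m j) / r)]

end

/-! ### Hausdorff and Assouad dimension -/

/-- The Hausdorff dimension of a bounded set is at most each of its Assouad exponents. -/
theorem AssouadExponent.dimH_le {X : Type*} [MetricSpace X] {F : Set X} (hF : Bornology.IsBounded F)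
    {s : ℝ≥0} (h : AssouadExponent F s) : dimH F ≤ s := by
  borelize X
  rcases F.eq_empty_or_nonempty with rfl | ⟨x, hx⟩
  · simp
  obtain ⟨C, hC, h⟩ := h
  obtain ⟨R, hR0, hR⟩ := hF.subset_closedBall_lt 0 x
  have hr (n : ℕ) : 0 < R / (n + 2) := by positivity
  have hrR (n : ℕ) : R / (n + 2) < R := div_lt_self hR0 (by linarith [n.cast_nonneg (α := ℝ)])
  choose t ht htF using fun n : ℕ => h x hx (R / (n + 2)) R (hr n) (hrR n)
  have hd (n : ℕ) (i : t n) : Metric.ediam (Metric.closedBall (i : X) (R / (n + 2))) ≤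
      ENNReal.ofReal (2 * (R / (n + 2))) := by
    rw [← Metric.closedEBall_ofReal (hr n).le]
    refine Metric.ediam_closedEBall_le.trans_eq ?_
    rw [ENNReal.ofReal_mul zero_le_two, ENNReal.ofReal_ofNat]
  refine dimH_le_of_hausdorffMeasure_ne_top (ne_top_of_le_ne_top
    (b := ENNReal.ofReal (C * (2 * R) ^ (s : ℝ))) ENNReal.ofReal_ne_top ?_)
  refine (MeasureTheory.Measure.hausdorffMeasure_le_liminf_sum (l := atTop) (s : ℝ) F
    (fun n : ℕ => ENNReal.ofReal (2 * (R / (n + 2)))) ?_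
    (fun n (i : t n) => Metric.closedBall (i : X) (R / (n + 2))) (.of_forall hd) ?_).trans ?_
  · have : Tendsto (fun n : ℕ => 2 * (R / ((n : ℝ) + 2))) atTop (𝓝 0) := by
      rw [← mul_zero (2 : ℝ)]
      exact tendsto_const_nhds.mul (tendsto_const_nhds.div_atTop
        (tendsto_atTop_add_const_right _ _ tendsto_natCast_atTop_atTop))
    simpa using ENNReal.tendsto_ofReal this
  · refine .of_forall fun n y hy => ?_
    obtain ⟨z, hz, hyz⟩ := mem_iUnion₂.1 (htF n ⟨hy, hR hy⟩)
    exact mem_iUnion.2 ⟨⟨z, hz⟩, hyz⟩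
  · refine liminf_le_of_le (by isBoundedDefault) fun b hb => ?_
    obtain ⟨n, hn⟩ := hb.exists
    refine hn.trans ?_
    calc ∑ i : t n, Metric.ediam (Metric.closedBall (i : X) (R / (n + 2))) ^ (s : ℝ)
        ≤ ∑ _i : t n, ENNReal.ofReal ((2 * (R / (n + 2))) ^ (s : ℝ)) := by
          gcongr with i
          rw [← ENNReal.ofReal_rpow_of_nonneg (by positivity) s.coe_nonneg]
          exact ENNReal.rpow_le_rpow (hd n i) s.coe_nonneg
      _ = ENNReal.ofReal ((t n).card * (2 * (R / (n + 2))) ^ (s : ℝ)) := by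
          rw [Finset.sum_const, Finset.card_univ, Fintype.card_coe, nsmul_eq_mul,
            ENNReal.ofReal_mul (Nat.cast_nonneg _), ENNReal.ofReal_natCast]
      _ ≤ ENNReal.ofReal (C * (R / (R / (n + 2))) ^ (s : ℝ) * (2 * (R / (n + 2))) ^ (s : ℝ)) := by
          gcongr
          exact ht n
      _ = ENNReal.ofReal (C * (2 * R) ^ (s : ℝ)) := by
          rw [mul_assoc, ← Real.mul_rpow (by positivity) (by positivity)]
          congr 3
          field_simp

theorem dimH_le_assouadDim {X : Type*} [MetricSpace X] {F : Set X} (hF : Bornology.IsBounded F) :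
    dimH F ≤ assouadDim F :=
  le_iInf₂ fun _ h => h.dimH_le hF

theorem assouadDim_le_of_forall_lt {X : Type*} [MetricSpace X] {F : Set X} {d : ℝ≥0}
    (h : ∀ s, d < s → AssouadExponent F s) : assouadDim F ≤ d := by
  refine ENNReal.le_of_forall_nnreal_lt fun r hr => ?_
  by_contra! hlt
  have hlt' : d < r := by exact_mod_cast hlt
  obtain ⟨s, hs, hsr⟩ := exists_between hlt'
  have h1 : assouadDim F ≤ s := iInf₂_le s (h s hs)
  exact absurd (hr.le.trans h1) (by exact_mod_cast not_le.2 hsr)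

/-- It suffices to verify the covering condition at scales up to the size of the set. -/
theorem AssouadExponent.of_le {X : Type*} [PseudoMetricSpace X] {F : Set X} {s : ℝ≥0} {D C : ℝ}
    (hD : 0 < D) (hC : 0 < C) (hF : ∀ x ∈ F, F ⊆ Metric.closedBall x D)
    (h : ∀ x ∈ F, ∀ r R : ℝ, 0 < r → r < R → R ≤ D →
      ∃ t : Finset X, (t.card : ℝ) ≤ C * (R / r) ^ (s : ℝ) ∧
        F ∩ Metric.closedBall x R ⊆ ⋃ y ∈ t, Metric.closedBall y r) : AssouadExponent F s := by
  refine ⟨max C 1, by positivity, fun x hx r R hr hrR => ?_⟩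
  have hR : 0 < R := hr.trans hrR
  rcases le_total R D with hRD | hRD
  · obtain ⟨t, ht, hsub⟩ := h x hx r R hr hrR hRD
    refine ⟨t, ht.trans ?_, hsub⟩
    gcongr
    exact le_max_left _ _
  · rcases lt_or_ge r D with hrD | hrD
    · obtain ⟨t, ht, hsub⟩ := h x hx r D hr hrD le_rfl
      refine ⟨t, ht.trans ?_, fun y hy => hsub ⟨hy.1, hF x hx hy.1⟩⟩
      gcongr
      exact le_max_left _ _
    · refine ⟨{x}, ?_, fun y hy => ?_⟩
      · rw [Finset.card_singleton, Nat.cast_one]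
        exact one_le_mul_of_one_le_of_one_le (le_max_right _ _)
          (Real.one_le_rpow ((one_le_div hr).2 hrR.le) s.coe_nonneg)
      · simpa using Metric.closedBall_subset_closedBall hrD (hF x hx hy.1)

/-- A subset of a line satisfies the covering condition with exponent one. -/
theorem AssouadExponent.of_collinear {F : Set Plane} (hF : Collinear ℝ F) : AssouadExponent F 1 := by
  classical
  refine ⟨3, by norm_num, fun x hx r R hr hrR => ?_⟩
  have hR : 0 < R := hr.trans hrR
  obtain ⟨v, hv⟩ := (collinear_iff_of_mem hx).1 hF
  obtain ⟨u, hu, hFu⟩ : ∃ u : Plane, ‖u‖ = 1 ∧ ∀ p ∈ F, ∃ t : ℝ, p = x + t • u := by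
    rcases eq_or_ne v 0 with rfl | hv0
    · refine ⟨EuclideanSpace.single 0 1, by simp, fun p hp => ⟨0, ?_⟩⟩
      obtain ⟨t, ht⟩ := hv p hp
      simpa using ht
    · refine ⟨‖v‖⁻¹ • v, by simp [norm_smul, hv0], fun p hp => ?_⟩
      obtain ⟨t, ht⟩ := hv p hp
      refine ⟨t * ‖v‖, ?_⟩
      rw [smul_smul, mul_assoc, mul_inv_cancel₀ (norm_ne_zero_iff.2 hv0), mul_one, add_comm]
      exact ht
  refine ⟨(Finset.range (⌊2 * R / r⌋₊ + 1)).image fun i : ℕ => x + (i * r - R) • u, ?_, ?_⟩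
  · have h1 : 1 ≤ R / r := (one_le_div hr).2 hrR.le
    calc _ ≤ ((⌊2 * R / r⌋₊ + 1 : ℕ) : ℝ) := by
          exact_mod_cast Finset.card_image_le.trans (Finset.card_range _).le
      _ ≤ 2 * R / r + 1 := by
          push_cast
          gcongr
          exact Nat.floor_le (by positivity)
      _ ≤ _ := by
          rw [NNReal.coe_one, Real.rpow_one]
          linarith [mul_div_assoc 2 R r]
  · rintro p ⟨hp, hpR⟩
    obtain ⟨t, rfl⟩ := hFu p hp
    rw [mem_closedBall_iff_norm, add_sub_cancel_left, norm_smul, hu, mul_one, Real.norm_eq_abs,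
      abs_le] at hpR
    have hq0 : 0 ≤ (t + R) / r := div_nonneg (by linarith) hr.le
    have hqr : (t + R) / r * r = t + R := div_mul_cancel₀ _ hr.ne'
    refine mem_iUnion₂.2 ⟨_, Finset.mem_image_of_mem _ (Finset.mem_range.2
      (Nat.lt_succ_of_le (Nat.floor_mono (a := (t + R) / r) (by gcongr; linarith)))), ?_⟩
    rw [mem_closedBall_iff_norm, add_sub_add_left_eq_sub, ← sub_smul, norm_smul, hu, mul_one,
      Real.norm_eq_abs, abs_le]
    constructor <;> nlinarith [Nat.floor_le hq0, Nat.lt_floor_add_one ((t + R) / r)]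

theorem AssouadExponent.mono {X : Type*} [PseudoMetricSpace X] {F : Set X} {s s' : ℝ≥0}
    (h : AssouadExponent F s) (hs : s ≤ s') : AssouadExponent F s' := by
  obtain ⟨C, hC, h⟩ := h
  refine ⟨C, hC, fun x hx r R hr hrR => ?_⟩
  obtain ⟨t, ht, hsub⟩ := h x hx r R hr hrR
  refine ⟨t, ht.trans ?_, hsub⟩
  gcongr
  exact (one_le_div hr).2 hrR.le

/-! ### Visible parts -/

theorem norm_direction (e : Direction) : ‖(e : Plane)‖ = 1 := norm_eq_of_mem_sphere e

theorem norm_sq_eq_cross_sq_add_inner_sq (e : Direction) (x : Plane) :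
    ‖x‖ ^ 2 = cross e x ^ 2 + ⟪(e : Plane), x⟫ ^ 2 := by
  rw [cross_sq_add_inner_sq, norm_direction, one_pow, one_mul]

theorem abs_cross_direction_le (e : Direction) (x : Plane) : |cross e x| ≤ ‖x‖ := by
  simpa [norm_direction] using abs_cross_le e x

theorem abs_inner_direction_le (e : Direction) (x : Plane) : |⟪(e : Plane), x⟫| ≤ ‖x‖ := by
  simpa [norm_direction] using abs_inner_le e x

theorem inner_direction_self (e : Direction) : ⟪(e : Plane), (e : Plane)⟫ = 1 := by
  rw [real_inner_self_eq_norm_sq, norm_direction, one_pow]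

theorem eq_of_cross_eq_of_inner_eq {e : Direction} {x y : Plane} (h : cross e x = cross e y)
    (h' : ⟪(e : Plane), x⟫ = ⟪(e : Plane), y⟫) : x = y := by
  have := norm_sq_eq_cross_sq_add_inner_sq e (x - y)
  rw [cross_sub, inner_sub_right, h, h', sub_self, sub_self] at this
  have h0 : ‖x - y‖ = 0 := by simpa using this
  exact sub_eq_zero.1 (norm_eq_zero.1 h0)

theorem continuous_cross (x : Plane) : Continuous (cross x) := by
  unfold cross; fun_prop

theorem exists_cross_eq_inner_eq (e : Direction) (u v : ℝ) :
    ∃ x : Plane, cross e x = u ∧ ⟪(e : Plane), x⟫ = v := by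
  have he : (e : Plane) 0 ^ 2 + (e : Plane) 1 ^ 2 = 1 := by
    rw [← norm_sq_eq, norm_direction, one_pow]
  refine ⟨u • !₂[-(e : Plane) 1, (e : Plane) 0] + v • (e : Plane), ?_, ?_⟩
  · rw [cross_add, cross_smul, cross_smul, cross_self]
    simp only [cross, Matrix.cons_val_zero, Matrix.cons_val_one]
    linear_combination u * he
  · rw [inner_add_right, real_inner_smul_right, real_inner_smul_right, inner_direction_self,
      inner_eq]
    simp only [Matrix.cons_val_zero, Matrix.cons_val_one]
    ring

theorem mem_vis_iff {e : Direction} {E : Set Plane} {x : Plane} :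
    x ∈ vis e E ↔ x ∈ E ∧ ∀ y ∈ E, cross e y = cross e x → ⟪(e : Plane), y⟫ ≤ ⟪(e : Plane), x⟫ := by
  constructor
  · intro hx
    have hx : halfLine x e ∩ E = {x} := hx
    refine ⟨(hx.ge (mem_singleton x)).2, fun y hy hxy => ?_⟩
    by_contra! hlt
    have hmem : y ∈ halfLine x e := by
      refine ⟨⟪(e : Plane), y⟫ - ⟪(e : Plane), x⟫, by linarith, ?_⟩
      apply eq_of_cross_eq_of_inner_eq (e := e)
      · rw [cross_add, cross_smul, cross_self, hxy]; ring
      · rw [inner_add_right, real_inner_smul_right, inner_direction_self]; ring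
    have : y = x := hx.le ⟨hmem, hy⟩
    rw [this] at hlt
    exact lt_irrefl _ hlt
  · rintro ⟨hx, hmax⟩
    refine Subset.antisymm ?_ (singleton_subset_iff.2 ⟨⟨0, le_rfl, by simp⟩, hx⟩)
    rintro y ⟨⟨t, ht, rfl⟩, hy⟩
    have h := hmax _ hy (by rw [cross_add, cross_smul, cross_self]; ring)
    rw [inner_add_right, real_inner_smul_right, inner_direction_self] at h
    have : t = 0 := by linarith
    simp [this]

theorem vis_subset (e : Direction) (E : Set Plane) : vis e E ⊆ E := fun _ hx => (mem_vis_iff.1 hx).1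

theorem exists_mem_vis {e : Direction} {E : Set Plane} (hE : IsCompact E) {x : Plane} (hx : x ∈ E) :
    ∃ y ∈ vis e E, cross e y = cross e x := by
  have hK : IsCompact (E ∩ {y | cross e y = cross e x}) :=
    hE.inter_right (isClosed_eq (continuous_cross e) continuous_const)
  obtain ⟨y, ⟨hy, hyx⟩, hmax⟩ := hK.exists_isMaxOn ⟨x, hx, rfl⟩
    (f := fun y => ⟪(e : Plane), y⟫) (by fun_prop)
  exact ⟨y, mem_vis_iff.2 ⟨hy, fun z hz hzy => hmax ⟨hz, hzy.trans hyx⟩⟩, hyx⟩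

theorem dimH_vis_ge {e : Direction} {E : Set Plane} (hE : IsCompact E) {J : Set Plane} (hJ : J ⊆ E)
    (hconv : Convex ℝ (cross e '' J)) (hnt : (cross e '' J).Nontrivial) : 1 ≤ dimH (vis e E) := by
  have hsub : cross e '' J ⊆ cross e '' vis e E := by
    rintro _ ⟨x, hx, rfl⟩
    exact exists_mem_vis hE (hJ hx)
  have hlip : LipschitzWith 1 (cross (e : Plane)) := by
    refine LipschitzWith.of_dist_le_mul fun x y => ?_
    rw [Real.dist_eq, ← cross_sub, dist_eq_norm, NNReal.coe_one, one_mul]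
    exact abs_cross_direction_le e _
  obtain ⟨a, ha, b, hb, hab⟩ := hnt.exists_lt
  have hint : (interior (cross e '' J)).Nonempty :=
    (nonempty_Ioo.2 hab).mono (interior_maximal
      (Ioo_subset_Icc_self.trans (hconv.ordConnected.out ha hb)) isOpen_Ioo)
  have h1 : dimH (cross e '' J) = 1 := by
    rw [Real.dimH_of_nonempty_interior hint, Module.finrank_self, Nat.cast_one]
  rw [← h1]
  exact (dimH_mono hsub).trans (hlip.dimH_image_le _)

/-- Each point of `E` lies, at each scale `ρ ≤ ρ₀`, in a part of `E` of diameter at most `ρ` whose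
projection along `e` is an interval of length at least `c ρ`. -/
def HasWideParts (E : Set Plane) (e : Direction) (c ρ₀ : ℝ) : Prop :=
  ∀ y ∈ E, ∀ ρ : ℝ, 0 < ρ → ρ ≤ ρ₀ → ∃ J ⊆ E, y ∈ J ∧ (∀ x ∈ J, ∀ z ∈ J, dist x z ≤ ρ) ∧
    Convex ℝ (cross e '' J) ∧ ∃ p ∈ J, ∃ q ∈ J, c * ρ ≤ |cross e p - cross e q|

theorem HasWideParts.extend {E : Set Plane} {e : Direction} {c ρ₀ ρ₁ : ℝ} (hc : 0 < c)
    (hρ₀ : 0 < ρ₀) (h : HasWideParts E e c ρ₀) (hρ : ρ₀ ≤ ρ₁) :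
    HasWideParts E e (c * ρ₀ / ρ₁) ρ₁ := by
  intro y hy ρ hρ0 hρ1
  have hρ₁ : 0 < ρ₁ := hρ₀.trans_le hρ
  rcases le_total ρ ρ₀ with hle | hle
  · obtain ⟨J, hJ, hyJ, hd, hconv, p, hp, q, hq, hpq⟩ := h y hy ρ hρ0 hle
    refine ⟨J, hJ, hyJ, hd, hconv, p, hp, q, hq, le_trans ?_ hpq⟩
    gcongr
    rw [div_le_iff₀ hρ₁]
    gcongr
  · obtain ⟨J, hJ, hyJ, hd, hconv, p, hp, q, hq, hpq⟩ := h y hy ρ₀ hρ₀ le_rfl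
    refine ⟨J, hJ, hyJ, fun x hx z hz => (hd x hx z hz).trans hle, hconv, p, hp, q, hq,
      le_trans ?_ hpq⟩
    rw [div_mul_eq_mul_div, div_le_iff₀ hρ₁]
    gcongr

/-- The height of the visible part over a point of the line orthogonal to `e`, measured from `b`
and truncated to `[0, H]`. -/
noncomputable def heightFn (E : Set Plane) (e : Direction) (b H t : ℝ) : ℝ :=
  sSup ((fun y : Plane => max 0 (min (⟪(e : Plane), y⟫ - b) H)) '' (E ∩ {y | cross e y = t}))

section

variable {E : Set Plane} {e : Direction} {b H t : ℝ}

theorem heightFn_nonneg : 0 ≤ heightFn E e b H t :=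
  Real.sSup_nonneg (by rintro _ ⟨y, -, rfl⟩; exact le_max_left _ _)

theorem heightFn_le (hH : 0 ≤ H) : heightFn E e b H t ≤ H :=
  Real.sSup_le (by rintro _ ⟨y, -, rfl⟩; exact max_le hH (min_le_right _ _)) hH

theorem le_heightFn (hH : 0 ≤ H) {y : Plane} (hy : y ∈ E) :
    max 0 (min (⟪(e : Plane), y⟫ - b) H) ≤ heightFn E e b H (cross e y) :=
  le_csSup ⟨H, by rintro _ ⟨y, -, rfl⟩; exact max_le hH (min_le_right _ _)⟩
    (mem_image_of_mem _ ⟨hy, rfl⟩)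

theorem heightFn_eq_of_mem_vis (hH : 0 ≤ H) {y : Plane} (hy : y ∈ vis e E) :
    heightFn E e b H (cross e y) = max 0 (min (⟪(e : Plane), y⟫ - b) H) := by
  obtain ⟨hyE, hmax⟩ := mem_vis_iff.1 hy
  refine le_antisymm (csSup_le ⟨_, mem_image_of_mem _ ⟨hyE, rfl⟩⟩ ?_) (le_heightFn hH hyE)
  rintro _ ⟨z, ⟨hz, hzy⟩, rfl⟩
  have := hmax z hz hzy
  dsimp only
  gcongr

theorem noThinPeaks_heightFn (hE : IsCompact E) {c ρ₀ : ℝ} (h : HasWideParts E e c ρ₀)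
    (hH : 0 ≤ H) (hHρ : H ≤ ρ₀) : NoThinPeaks (c / 2) (heightFn E e b H) := by
  intro t ρ hρ
  by_cases ht : ∃ x ∈ E, cross e x = t
  · obtain ⟨x, hx, rfl⟩ := ht
    obtain ⟨y, hy, hyx⟩ := exists_mem_vis (e := e) hE hx
    rw [← hyx]
    rcases le_total ρ ρ₀ with hle | hle
    · obtain ⟨J, hJ, hyJ, hd, hconv, p, hp, q, hq, hpq⟩ := h y (vis_subset e E hy) ρ hρ hle
      have key : ∀ z ∈ J, heightFn E e b H (cross e y) - ρ ≤ heightFn E e b H (cross e z) := by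
        intro z hz
        refine le_trans ?_ (le_heightFn hH (hJ hz))
        rw [heightFn_eq_of_mem_vis hH hy]
        have h1 : ⟪(e : Plane), y⟫ - ⟪(e : Plane), z⟫ ≤ ρ := by
          rw [← inner_sub_right]
          refine (le_abs_self _).trans ((abs_inner_direction_le e _).trans ?_)
          rw [← dist_eq_norm]
          exact hd y hyJ z hz
        rw [sub_le_iff_le_add]
        refine max_le (by positivity) ?_
        rcases le_total (⟪(e : Plane), z⟫ - b) H with h2 | h2
        · have := min_le_left (⟪(e : Plane), y⟫ - b) H
          rw [min_eq_left h2]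
          linarith [le_max_right 0 (⟪(e : Plane), z⟫ - b)]
        · have := min_le_right (⟪(e : Plane), y⟫ - b) H
          rw [min_eq_right h2]
          linarith [le_max_right 0 H]
      have hconv' := hconv.ordConnected
      have side : ∀ z ∈ J, c * ρ / 2 ≤ |cross e z - cross e y| →
          (∀ s ∈ Icc (cross e y - c / 2 * ρ) (cross e y),
            heightFn E e b H (cross e y) - ρ ≤ heightFn E e b H s) ∨
          (∀ s ∈ Icc (cross e y) (cross e y + c / 2 * ρ),
            heightFn E e b H (cross e y) - ρ ≤ heightFn E e b H s) := by
        intro z hz hzy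
        rcases le_abs.1 hzy with h1 | h1
        · refine Or.inr fun s hs => ?_
          obtain ⟨v, hv, rfl⟩ := hconv'.out (mem_image_of_mem _ hyJ) (mem_image_of_mem _ hz)
            ⟨hs.1, by linarith [hs.2]⟩
          exact key v hv
        · refine Or.inl fun s hs => ?_
          obtain ⟨v, hv, rfl⟩ := hconv'.out (mem_image_of_mem _ hz) (mem_image_of_mem _ hyJ)
            ⟨by linarith [hs.1], hs.2⟩
          exact key v hv
      by_cases hp2 : c * ρ / 2 ≤ |cross e p - cross e y|
      · exact side p hp hp2
      · refine side q hq ?_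
        have h3 := abs_sub_le (cross e p) (cross e y) (cross e q)
        rw [abs_sub_comm (cross e y)] at h3
        linarith
    · refine Or.inl fun s _ => ?_
      have h1 := heightFn_le (E := E) (e := e) (b := b) (t := cross e y) hH
      have h2 := heightFn_nonneg (E := E) (e := e) (b := b) (H := H) (t := s)
      linarith
  · have h0 : heightFn E e b H t = 0 := by
      have : E ∩ {y | cross e y = t} = ∅ := by
        refine eq_empty_of_forall_notMem fun y hy => ht ⟨y, hy.1, hy.2⟩
      rw [heightFn, this, image_empty, Real.sSup_empty]
    refine Or.inl fun s _ => ?_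
    rw [h0]
    linarith [heightFn_nonneg (E := E) (e := e) (b := b) (H := H) (t := s)]

end

/-- The count of boxes, at `k` with `2 ^ k` comparable to `R / r`, in terms of a power. -/
theorem box_count_le {s δ R r : ℝ} (hs : 1 < s) (hδ : 0 < δ) (hr : 0 < r) (hrR : r < R) {k : ℕ}
    (hk : (2 : ℝ) ^ k ≤ 8 * (R / r)) :
    2 ^ k + (2 * k + 1) * (2 * (2 * R) / δ + 2 * (2 * R)) / (r / 2) ≤
      (8 + (2 * 8 ^ (s - 1) / ((s - 1) * Real.log 2) + 1) * (8 / δ + 8)) * (R / r) ^ s := by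
  set Q := R / r with hQ
  have hQ1 : 1 ≤ Q := (one_le_div hr).2 hrR.le
  have hε : 0 < s - 1 := by linarith
  have hlog : 0 < Real.log 2 := Real.log_pos one_lt_two
  have hk1 : (k : ℝ) ≤ 8 ^ (s - 1) / ((s - 1) * Real.log 2) * Q ^ (s - 1) := by
    have h1 : k * Real.log 2 ≤ (8 * Q) ^ (s - 1) / (s - 1) := by
      rw [← Real.log_pow]
      exact (Real.log_le_log (by positivity) hk).trans
        (Real.log_le_rpow_div (by positivity) hε)
    rw [Real.mul_rpow (by norm_num) (by positivity)] at h1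
    rw [← le_div_iff₀ hlog] at h1
    refine h1.trans_eq ?_
    field_simp
  have hQε : 1 ≤ Q ^ (s - 1) := Real.one_le_rpow hQ1 hε.le
  have hQs : Q ^ s = Q ^ (s - 1) * Q := by
    rw [← Real.rpow_add_one (by positivity), sub_add_cancel]
  have e1 : (2 * (k : ℝ) + 1) * (2 * (2 * R) / δ + 2 * (2 * R)) / (r / 2) =
      (2 * k + 1) * (8 / δ + 8) * Q := by
    rw [hQ]; field_simp; ring
  rw [e1]
  calc 2 ^ k + (2 * (k : ℝ) + 1) * (8 / δ + 8) * Q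
      ≤ 8 * (Q ^ (s - 1) * Q) + (2 * (8 ^ (s - 1) / ((s - 1) * Real.log 2) * Q ^ (s - 1)) +
        Q ^ (s - 1)) * (8 / δ + 8) * Q := by
        gcongr
        refine hk.trans ?_
        gcongr
        exact le_mul_of_one_le_left (by positivity) hQε
    _ = _ := by rw [hQs]; ring

theorem assouadExponent_vis {E : Set Plane} {e : Direction} (hE : IsCompact E) {c ρ₀ : ℝ}
    (hc : 0 < c) (hρ₀ : 0 < ρ₀) (h : HasWideParts E e c ρ₀) {s : ℝ≥0} (hs : 1 < s) :
    AssouadExponent (vis e E) s := by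
  classical
  obtain ⟨D, hD0, hD⟩ : ∃ D, 0 < D ∧ ∀ x ∈ E, E ⊆ Metric.closedBall x D := by
    obtain ⟨D, hD⟩ := Metric.isBounded_iff.1 hE.isBounded
    exact ⟨max D 1, by positivity, fun x hx y hy => (hD hy hx).trans (le_max_left _ _)⟩
  have hρ₁ : ρ₀ ≤ max ρ₀ (2 * D) := le_max_left _ _
  have hwide := h.extend hc hρ₀ hρ₁
  set ρ₁ := max ρ₀ (2 * D)
  have hρ₁0 : 0 < ρ₁ := hρ₀.trans_le hρ₁
  set δ := c * ρ₀ / ρ₁ / 2 with hδdef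
  have hδ : 0 < δ := by positivity
  have hs' : (1 : ℝ) < s := by exact_mod_cast hs
  have hε : 0 < (s : ℝ) - 1 := by linarith
  have hlog : 0 < Real.log 2 := Real.log_pos one_lt_two
  refine AssouadExponent.of_le hD0 (C := 8 + (2 * 8 ^ ((s : ℝ) - 1) /
    (((s : ℝ) - 1) * Real.log 2) + 1) * (8 / δ + 8)) (by positivity)
    (fun x hx => (vis_subset e E).trans (hD x (vis_subset e E hx))) fun x hx r R hr hrR hRD => ?_
  have hR : 0 < R := hr.trans hrR
  set b := ⟪(e : Plane), x⟫ - R with hb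
  have hQ1 : 1 ≤ R / r := (one_le_div hr).2 hrR.le
  obtain ⟨n, hn1, hn2⟩ := exists_nat_pow_near (show 1 ≤ 4 * (R / r) by linarith)
    (one_lt_two (α := ℝ))
  have hthin := noThinPeaks_heightFn (b := b) (H := 2 * R) hE hwide (by positivity)
    (le_trans (by linarith) (le_max_right ρ₀ (2 * D)))
  obtain ⟨P, hPcard, hP⟩ := exists_box_cover (a := cross e x - R) (H := 2 * R) (W := 2 * R)
    (r := r / 2) (fun _ => heightFn_nonneg) (fun _ => heightFn_le (by positivity)) hδ hthin
    (by positivity) (by positivity) (n + 1)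
  choose z hz1 hz2 using exists_cross_eq_inner_eq e
  refine ⟨P.image fun p => z p.1 (p.2 + b), ?_, ?_⟩
  · refine le_trans (by exact_mod_cast Finset.card_image_le) (hPcard.trans ?_)
    exact box_count_le hs' hδ hr hrR (by rw [pow_succ]; linarith)
  · rintro y ⟨hy, hyx⟩
    rw [mem_closedBall_iff_norm] at hyx
    have h1 := (abs_cross_direction_le e (y - x)).trans hyx
    have h2 := (abs_inner_direction_le e (y - x)).trans hyx
    rw [cross_sub, abs_le] at h1
    rw [inner_sub_right, abs_le] at h2
    obtain ⟨p, hp, hp1, hp2⟩ := hP (cross e y) ⟨by linarith, by linarith⟩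
    rw [heightFn_eq_of_mem_vis (by positivity) hy, min_eq_left (by linarith),
      max_eq_right (by linarith)] at hp2
    have hw : 2 * R / 2 ^ (n + 1) ≤ r / 2 := by
      rw [div_le_iff₀ (by positivity)]
      have : 4 * (R / r) * r = 4 * R := by field_simp
      nlinarith
    refine mem_iUnion₂.2 ⟨_, Finset.mem_image_of_mem _ hp, ?_⟩
    rw [mem_closedBall_iff_norm, ← sq_le_sq₀ (norm_nonneg _) hr.le,
      norm_sq_eq_cross_sq_add_inner_sq e, cross_sub, inner_sub_right, hz1, hz2]
    have h3 := sq_le_sq₀ (abs_nonneg _) (by positivity) |>.2 (hp1.trans hw)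
    have h4 := sq_le_sq₀ (abs_nonneg _) (by positivity) |>.2 hp2
    rw [sq_abs] at h3 h4
    rw [show ⟪(e : Plane), y⟫ - (p.2 + b) = ⟪(e : Plane), y⟫ - b - p.2 by ring]
    nlinarith

namespace AffineIFS

variable {κ : ℕ} (Φ : AffineIFS κ)

/-! ### Cylinders -/

theorem wordLinear_append (w u : List (Fin κ)) :
    Φ.wordLinear (w ++ u) = Φ.wordLinear w * Φ.wordLinear u := by
  simp [wordLinear]

theorem wordLinear_append_apply (w u : List (Fin κ)) (x : Plane) :
    Φ.wordLinear (w ++ u) x = Φ.wordLinear w (Φ.wordLinear u x) := by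
  rw [wordLinear_append]; rfl

theorem wordLinear_cons_apply (i : Fin κ) (w : List (Fin κ)) (x : Plane) :
    Φ.wordLinear (i :: w) x = Φ.A i (Φ.wordLinear w x) := by
  simp only [wordLinear, List.map_cons, List.prod_cons]; rfl

theorem wordLinear_singleton_apply (i : Fin κ) (x : Plane) : Φ.wordLinear [i] x = Φ.A i x :=
  Φ.wordLinear_cons_apply i [] x

theorem wordMap_sub (w : List (Fin κ)) (x y : Plane) :
    Φ.wordMap w x - Φ.wordMap w y = Φ.wordLinear w (x - y) := by
  induction w with
  | nil => rfl
  | cons i w ih =>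
    rw [wordLinear_cons_apply, ← ih]
    simp [wordMap, map]

theorem wordMap_append (w u : List (Fin κ)) : Φ.wordMap (w ++ u) = Φ.wordMap w ∘ Φ.wordMap u := by
  induction w with
  | nil => rfl
  | cons i w ih => rw [List.cons_append, wordMap, ih, wordMap, Function.comp_assoc]

theorem IsAttractor.wordMap_image_subset {Φ : AffineIFS κ} {E : Set Plane} (hE : Φ.IsAttractor E)
    (w : List (Fin κ)) : Φ.wordMap w '' E ⊆ E := by
  induction w with
  | nil => simp [wordMap]
  | cons i w ih =>
    rw [wordMap, image_comp]
    conv_rhs => rw [hE.2.2]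
    exact (image_mono ih).trans (subset_iUnion (fun i => Φ.map i '' E) i)

theorem IsAttractor.exists_extension {Φ : AffineIFS κ} {E : Set Plane} (hE : Φ.IsAttractor E)
    {w : List (Fin κ)} {y : Plane} (hy : y ∈ Φ.wordMap w '' E) :
    ∃ i, y ∈ Φ.wordMap (w ++ [i]) '' E := by
  obtain ⟨x, hx, rfl⟩ := hy
  rw [hE.2.2] at hx
  obtain ⟨i, z, hz, rfl⟩ := mem_iUnion.1 hx
  exact ⟨i, z, hz, by rw [wordMap_append]; rfl⟩

theorem exists_contraction_bounds : ∃ κ₀ q : ℝ, 0 < κ₀ ∧ 0 ≤ q ∧ q < 1 ∧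
    ∀ i, ‖(Φ.A i : Plane →L[ℝ] Plane)‖ ≤ q ∧
      ‖((Φ.A i).symm : Plane →L[ℝ] Plane)‖ ≤ κ₀⁻¹ := by
  obtain ⟨M, hM⟩ := Finite.exists_le fun i => ‖((Φ.A i).symm : Plane →L[ℝ] Plane)‖
  obtain ⟨q, hq⟩ : ∃ q : ℝ, 0 ≤ q ∧ q < 1 ∧ ∀ i, ‖(Φ.A i : Plane →L[ℝ] Plane)‖ ≤ q := by
    rcases isEmpty_or_nonempty (Fin κ) with h | h
    · exact ⟨0, le_rfl, one_pos, fun i => isEmptyElim i⟩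
    · obtain ⟨j, hj⟩ := Finite.exists_max fun i => ‖(Φ.A i : Plane →L[ℝ] Plane)‖
      exact ⟨_, norm_nonneg _, Φ.contractive j, hj⟩
  refine ⟨(max M 1)⁻¹, q, by positivity, hq.1, hq.2.1, fun i => ⟨hq.2.2 i, ?_⟩⟩
  rw [inv_inv]
  exact (hM i).trans (le_max_left _ _)

theorem norm_wordLinear_le {q : ℝ} (hq : 0 ≤ q) (h : ∀ i, ‖(Φ.A i : Plane →L[ℝ] Plane)‖ ≤ q)
    (w : List (Fin κ)) : alpha₁ (Φ.wordLinear w) ≤ q ^ w.length := by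
  rw [← norm_eq_alpha₁]
  refine ContinuousLinearMap.opNorm_le_bound _ (by positivity) fun x => ?_
  induction w with
  | nil => simp [wordLinear]
  | cons i w ih =>
    rw [ContinuousLinearEquiv.coe_coe, wordLinear_cons_apply, List.length_cons, pow_succ', mul_assoc]
    refine ((Φ.A i : Plane →L[ℝ] Plane).le_opNorm _).trans ?_
    gcongr
    · exact h i
    · exact ih

theorem alpha₁_append_ge {κ₀ : ℝ} (hκ₀ : 0 < κ₀)
    (h : ∀ i, ‖((Φ.A i).symm : Plane →L[ℝ] Plane)‖ ≤ κ₀⁻¹) (w : List (Fin κ)) (i : Fin κ) :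
    κ₀ * alpha₁ (Φ.wordLinear w) ≤ alpha₁ (Φ.wordLinear (w ++ [i])) := by
  rw [← le_inv_mul_iff₀ hκ₀, ← norm_map_eta₁ (Φ.wordLinear w)]
  set η := eta₁ (Φ.wordLinear w)
  have h1 : Φ.wordLinear w η = Φ.wordLinear (w ++ [i]) ((Φ.A i).symm η) := by
    rw [wordLinear_append_apply, wordLinear_singleton_apply,
      ContinuousLinearEquiv.apply_symm_apply]
  have h2 : ‖(Φ.A i).symm η‖ ≤ κ₀⁻¹ := by
    have := ((Φ.A i).symm : Plane →L[ℝ] Plane).le_of_opNorm_le (h i) η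
    rwa [norm_eta₁, mul_one] at this
  rw [h1, mul_comm]
  refine (norm_map_le _ _).trans ?_
  gcongr
  exact alpha₁_nonneg _

theorem alpha₁_pos (A : Plane ≃L[ℝ] Plane) : 0 < alpha₁ A := by
  rw [← norm_map_eta₁]
  exact norm_pos_iff.2 (map_eta₁_ne_zero A)

theorem pow_le_alpha₁ {κ₀ : ℝ} (hκ₀ : 0 < κ₀)
    (h : ∀ i, ‖((Φ.A i).symm : Plane →L[ℝ] Plane)‖ ≤ κ₀⁻¹) (w : List (Fin κ)) :
    κ₀ ^ w.length ≤ alpha₁ (Φ.wordLinear w) := by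
  induction w using List.reverseRecOn with
  | nil =>
    rw [← norm_map_eta₁]
    exact (norm_eta₁ (Φ.wordLinear [])).ge
  | append_singleton w i ih =>
    refine le_trans ?_ (Φ.alpha₁_append_ge hκ₀ h w i)
    rw [List.length_append, List.length_singleton, pow_succ']
    gcongr

/-! ### Orientations of cylinders -/

/-- The longer semiaxis of `A_w(B(0,1))`. -/
noncomputable def axis (w : List (Fin κ)) : Plane := Φ.wordLinear w (eta₁ (Φ.wordLinear w))

theorem axis_ne_zero (w : List (Fin κ)) : Φ.axis w ≠ 0 := map_eta₁_ne_zero _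

theorem norm_axis (w : List (Fin κ)) : ‖Φ.axis w‖ = alpha₁ (Φ.wordLinear w) := norm_map_eta₁ _

theorem sinAngle_axis_append_singleton_le {κ₀ : ℝ} (hκ₀ : 0 < κ₀)
    (h : ∀ i, ‖((Φ.A i).symm : Plane →L[ℝ] Plane)‖ ≤ κ₀⁻¹) (w : List (Fin κ)) (i : Fin κ) :
    sinAngle (Φ.axis w) (Φ.axis (w ++ [i])) ≤
      κ₀⁻¹ * (alpha₂ (Φ.wordLinear w) / alpha₁ (Φ.wordLinear w)) := by
  have hpos := alpha₁_pos (Φ.wordLinear w)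
  have hpos' := alpha₁_pos (Φ.wordLinear (w ++ [i]))
  have hge := Φ.alpha₁_append_ge hκ₀ h w i
  have hcross : |cross (Φ.axis w) (Φ.axis (w ++ [i]))| ≤
      alpha₁ (Φ.wordLinear w) * alpha₂ (Φ.wordLinear w) := by
    rw [axis, axis, wordLinear_append_apply, wordLinear_singleton_apply, abs_cross_map]
    set η := eta₁ (Φ.wordLinear (w ++ [i])) with hη
    have h1 : ‖Φ.A i η‖ ≤ 1 := by
      have := (Φ.A i : Plane →L[ℝ] Plane).le_of_opNorm_le (Φ.contractive i).le η
      rwa [hη, norm_eta₁, mul_one] at this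
    have h2 := (abs_cross_le (eta₁ (Φ.wordLinear w)) (Φ.A i η))
    rw [norm_eta₁, one_mul] at h2
    exact mul_le_of_le_one_right (mul_nonneg hpos.le (alpha₂_nonneg _)) (h2.trans h1)
  rw [sinAngle, norm_axis, norm_axis, div_le_iff₀ (by positivity)]
  refine hcross.trans ?_
  have h3 : alpha₁ (Φ.wordLinear w) * alpha₂ (Φ.wordLinear w) =
      κ₀⁻¹ * (alpha₂ (Φ.wordLinear w) / alpha₁ (Φ.wordLinear w)) *
        (alpha₁ (Φ.wordLinear w) * (κ₀ * alpha₁ (Φ.wordLinear w))) := by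
    field_simp
  rw [h3]
  have := alpha₂_nonneg (Φ.wordLinear w)
  gcongr

/-- Under domination, the orientations of the extensions of a word converge exponentially fast. -/
theorem exists_sinAngle_axis_append_le (hdom : Φ.Dominated) :
    ∃ K q : ℝ, 0 ≤ q ∧ q < 1 ∧ ∃ n₀, ∀ w u : List (Fin κ), n₀ ≤ w.length →
      sinAngle (Φ.axis w) (Φ.axis (w ++ u)) ≤ K * q ^ w.length := by
  obtain ⟨τ, hτ, n₀, hn₀⟩ := hdom
  obtain ⟨κ₀, _, hκ₀, -, -, hA⟩ := Φ.exists_contraction_bounds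
  have hτ0 : 0 < τ := by linarith
  have hq1 : τ⁻¹ < 1 := inv_lt_one_of_one_lt₀ hτ
  have hq0 : 0 < τ⁻¹ := by positivity
  refine ⟨κ₀⁻¹ / (1 - τ⁻¹), τ⁻¹, hq0.le, hq1, n₀, fun w u hw => ?_⟩
  have hstep (v : List (Fin κ)) (hv : n₀ ≤ v.length) (i : Fin κ) :
      sinAngle (Φ.axis v) (Φ.axis (v ++ [i])) ≤ κ₀⁻¹ * τ⁻¹ ^ v.length := by
    refine (Φ.sinAngle_axis_append_singleton_le hκ₀ (fun i => (hA i).2) v i).trans ?_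
    gcongr
    rw [div_le_iff₀ (alpha₁_pos _), inv_pow, le_inv_mul_iff₀ (by positivity)]
    exact (hn₀ v hv).le
  have hq : 0 < 1 - τ⁻¹ := by linarith
  have key : sinAngle (Φ.axis w) (Φ.axis (w ++ u)) ≤
      κ₀⁻¹ / (1 - τ⁻¹) * (τ⁻¹ ^ w.length - τ⁻¹ ^ (w.length + u.length)) := by
    induction u using List.reverseRecOn with
    | nil => simp [sinAngle_self]
    | append_singleton u i ih =>
      rw [← List.append_assoc]
      refine (sinAngle_triangle _ _ (Φ.axis_ne_zero (w ++ u))).trans ?_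
      refine (add_le_add ih (hstep (w ++ u) (by simp; omega) i)).trans_eq ?_
      rw [List.length_append, List.length_append, List.length_singleton, ← add_assoc,
        pow_succ _ (w.length + u.length)]
      generalize τ⁻¹ = q at *
      field_simp
      ring
  refine key.trans ?_
  gcongr
  exact sub_le_self _ (by positivity)

/-- König's lemma for words. -/
theorem exists_infinite_word {T : List (Fin κ) → Prop} (h0 : T [])
    (hstep : ∀ w, T w → ∃ i, T (w ++ [i])) : ∃ i : ℕ → Fin κ, ∀ n, T (restrict i n) := by
  choose f hf using hstep
  let W : ℕ → {w // T w} := fun n => Nat.rec ⟨[], h0⟩ (fun _ w => ⟨w.1 ++ [f w.1 w.2], hf w.1 w.2⟩) n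
  refine ⟨fun n => f (W n).1 (W n).2, fun n => ?_⟩
  suffices restrict (fun n => f (W n).1 (W n).2) n = (W n).1 by
    rw [this]; exact (W n).2
  induction n with
  | zero => rfl
  | succ n ih =>
    have h1 : restrict (fun n => f (W n).1 (W n).2) (n + 1) =
        restrict (fun n => f (W n).1 (W n).2) n ++ [f (W n).1 (W n).2] := by
      rw [restrict, List.ofFn_succ', List.concat_eq_append]
      rfl
    rw [h1, ih]

theorem length_restrict (i : ℕ → Fin κ) (n : ℕ) : (restrict i n).length = n := by
  simp [restrict]

/-- The orientations of long cylinders stay away from a direction which is not a limit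
orientation. -/
theorem exists_le_sinAngle_axis (hdom : Φ.Dominated) {e : Direction}
    (he : lineOf e ∉ Φ.limitOrientations) :
    ∃ c > 0, ∃ n₁, ∀ w : List (Fin κ), n₁ ≤ w.length → c ≤ sinAngle (Φ.axis w) e := by
  by_contra! hbad
  obtain ⟨K, q, hq0, hq1, n₀, hK⟩ := Φ.exists_sinAngle_axis_append_le hdom
  let T : List (Fin κ) → Prop := fun v => ∀ c > 0, ∀ n, ∃ u : List (Fin κ), n ≤ u.length ∧
    sinAngle (Φ.axis (v ++ u)) e < c
  have hT0 : T [] := hbad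
  have hstep : ∀ v, T v → ∃ i, T (v ++ [i]) := by
    intro v hv
    by_contra! hno
    simp only [T] at hno
    push Not at hno
    choose c hc n hn using hno
    obtain ⟨M, hM⟩ := Finite.exists_le n
    rcases isEmpty_or_nonempty (Fin κ) with hκ | hκ
    · obtain ⟨u, hu, -⟩ := hv 1 one_pos 1
      rcases u with _ | ⟨i, u⟩
      · simp at hu
      · exact isEmptyElim i
    obtain ⟨j, hj⟩ := Finite.exists_min c
    obtain ⟨u, hu, hlt⟩ := hv (c j) (hc j) (M + 1)
    rcases u with _ | ⟨i, u⟩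
    · simp at hu
    · have h1 : v ++ i :: u = v ++ [i] ++ u := by simp
      rw [h1] at hlt
      have h2 := hn i u (by rw [List.length_cons] at hu; linarith [hM i])
      linarith [hj i]
  obtain ⟨i, hi⟩ := exists_infinite_word hT0 hstep
  refine he ⟨i, ?_⟩
  have hbound : ∀ n ≥ n₀, lineAngle (theta₁ (Φ.wordLinear (restrict i n))) (lineOf e) ≤
      Real.pi / 2 * (K * q ^ n) := by
    intro n hn
    refine (lineAngle_mk_le (map_eta₁_ne_zero _) (ne_zero_of_mem_unit_sphere e)).trans ?_
    have hpi := Real.pi_pos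
    gcongr
    refine le_of_forall_pos_le_add fun c hc => ?_
    obtain ⟨u, -, hu⟩ := hi n c hc 0
    have h1 := hK (restrict i n) u (by rwa [length_restrict])
    rw [length_restrict] at h1
    exact (sinAngle_triangle (Φ.axis (restrict i n)) e (Φ.axis_ne_zero (restrict i n ++ u))).trans
      (add_le_add h1 hu.le)
  have hlim : Tendsto (fun n : ℕ => Real.pi / 2 * (K * q ^ n)) atTop (𝓝 0) := by
    have := ((tendsto_pow_atTop_nhds_zero_of_lt_one hq0 hq1).const_mul K).const_mul (Real.pi / 2)
    simpa using this
  exact tendsto_of_tendsto_of_tendsto_of_le_of_le' tendsto_const_nhds hlim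
    (.of_forall fun n => lineAngle_nonneg _ _) (eventually_atTop.2 ⟨n₀, hbound⟩)

/-- Each point of the attractor lies in long cylinders of all small sizes. -/
theorem IsAttractor.exists_cylinder {Φ : AffineIFS κ} {E : Set Plane} (hE : Φ.IsAttractor E)
    (n₁ : ℕ) : ∃ κ₀ > 0, ∃ ρ₀ > 0, ∀ y ∈ E, ∀ ρ : ℝ, 0 < ρ → ρ ≤ ρ₀ →
      ∃ w : List (Fin κ), n₁ ≤ w.length ∧ y ∈ Φ.wordMap w '' E ∧
        κ₀ * ρ ≤ alpha₁ (Φ.wordLinear w) ∧ alpha₁ (Φ.wordLinear w) ≤ ρ := by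
  obtain ⟨κ₀, q, hκ₀, hq0, hq1, hA⟩ := Φ.exists_contraction_bounds
  refine ⟨min κ₀ 1, by positivity, κ₀ ^ n₁, by positivity, fun y hy ρ hρ hρ₀ => ?_⟩
  by_contra! hno
  have hex (n : ℕ) : ∃ w : List (Fin κ), w.length = n ∧ y ∈ Φ.wordMap w '' E := by
    induction n with
    | zero => exact ⟨[], rfl, y, hy, rfl⟩
    | succ n ih =>
      obtain ⟨w, hw, hyw⟩ := ih
      obtain ⟨i, hi⟩ := hE.exists_extension hyw
      exact ⟨w ++ [i], by simp [hw], hi⟩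
  have hlong (n : ℕ) : ∃ w : List (Fin κ), w.length = n₁ + n ∧ y ∈ Φ.wordMap w '' E ∧
      ρ ≤ alpha₁ (Φ.wordLinear w) := by
    induction n with
    | zero =>
      obtain ⟨w, hw, hyw⟩ := hex n₁
      refine ⟨w, hw, hyw, hρ₀.trans ?_⟩
      rw [← hw]
      exact Φ.pow_le_alpha₁ hκ₀ (fun i => (hA i).2) w
    | succ n ih =>
      obtain ⟨w, hw, hyw, hρw⟩ := ih
      obtain ⟨i, hi⟩ := hE.exists_extension hyw
      have hlen : (w ++ [i]).length = n₁ + (n + 1) := by simp [hw, add_assoc]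
      refine ⟨w ++ [i], hlen, hi, (hno (w ++ [i]) (by omega) hi ?_).le⟩
      refine le_trans ?_ (Φ.alpha₁_append_ge hκ₀ (fun i => (hA i).2) w i)
      gcongr
      exact min_le_left _ _
  obtain ⟨n, hn⟩ := exists_pow_lt_of_lt_one hρ hq1
  obtain ⟨w, hw, -, hρw⟩ := hlong n
  have h1 := Φ.norm_wordLinear_le hq0 (fun i => (hA i).1) w
  have h2 : q ^ w.length ≤ q ^ n := pow_le_pow_of_le_one hq0 hq1.le (by omega)
  linarith

end AffineIFS

/-! ### Projections of cylinders -/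

theorem cross_projAlong (e : Direction) (x : Plane) : cross e (projAlong e x) = cross e x := by
  rw [projAlong, Submodule.starProjection_orthogonal_val,
    Submodule.starProjection_unit_singleton ℝ (norm_direction e), cross_sub, cross_smul, cross_self,
    mul_zero, sub_zero]

theorem inner_projAlong (e : Direction) (x : Plane) : ⟪(e : Plane), projAlong e x⟫ = 0 := by
  rw [projAlong, Submodule.starProjection_orthogonal_val,
    Submodule.starProjection_unit_singleton ℝ (norm_direction e), inner_sub_right,
    real_inner_smul_right, inner_direction_self, mul_one, sub_self]

theorem IsNontrivialInterval.cross_image {e : Direction} {S : Set Plane}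
    (h : IsNontrivialInterval (projAlong e '' S)) :
    Convex ℝ (cross e '' S) ∧ (cross e '' S).Nontrivial := by
  have himg : cross e '' S = crossₗ e '' (projAlong e '' S) := by
    rw [image_image]
    exact image_congr fun x _ => (cross_projAlong e x).symm
  refine ⟨himg ▸ h.2.1.linear_image (crossₗ e), ?_⟩
  obtain ⟨_, ⟨x, hx, rfl⟩, _, ⟨y, hy, rfl⟩, hxy⟩ := h.2.2
  refine ⟨_, mem_image_of_mem _ hx, _, mem_image_of_mem _ hy, fun heq => hxy ?_⟩
  apply eq_of_cross_eq_of_inner_eq (e := e)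
  · rw [cross_projAlong, cross_projAlong, heq]
  · rw [inner_projAlong, inner_projAlong]

theorem exists_eq_smul_of_cross_eq_zero {v x : Plane} (hv : v ≠ 0) (h : cross v x = 0) :
    ∃ t : ℝ, x = t • v := by
  have hv' : 0 < ‖v‖ ^ 2 := by positivity
  refine ⟨⟪v, x⟫ / ‖v‖ ^ 2, sub_eq_zero.1 (norm_eq_zero.1 ?_)⟩
  have h1 := cross_sq_add_inner_sq v (x - (⟪v, x⟫ / ‖v‖ ^ 2) • v)
  rw [cross_sub, cross_smul, cross_self, h, inner_sub_right, real_inner_smul_right,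
    real_inner_self_eq_norm_sq, div_mul_cancel₀ _ hv'.ne'] at h1
  have h2 : ‖v‖ ^ 2 * ‖x - (⟪v, x⟫ / ‖v‖ ^ 2) • v‖ ^ 2 = 0 := by linarith
  simpa [hv'.ne', hv] using h2

theorem exists_cross_ne_zero_of_not_collinear {E : Set Plane} (hE : ¬ Collinear ℝ E) :
    ∃ p ∈ E, ∃ x ∈ E, ∃ y ∈ E, cross (x - p) (y - p) ≠ 0 := by
  by_contra! h
  rcases E.subsingleton_or_nontrivial with hs | ⟨p, hp, x, hx, hpx⟩
  · rcases hs.eq_empty_or_singleton with rfl | ⟨x, rfl⟩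
    · exact hE (collinear_empty ℝ Plane)
    · exact hE (collinear_singleton ℝ x)
  · refine hE ((collinear_iff_of_mem hp).2 ⟨x - p, fun y hy => ?_⟩)
    obtain ⟨t, ht⟩ := exists_eq_smul_of_cross_eq_zero (sub_ne_zero.2 hpx.symm) (h p hp x hx y hy)
    exact ⟨t, by rw [vadd_eq_add, ← ht, sub_add_cancel]⟩

/-- A linear form is controlled by its values at two linearly independent vectors. -/
theorem abs_linear_mul_cross_le (l : Plane →ₗ[ℝ] ℝ) (u v z : Plane) :
    |l z| * |cross u v| ≤ (|l u| * ‖v‖ + |l v| * ‖u‖) * ‖z‖ := by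
  have h : cross u v • z = cross z v • u + cross u z • v := by
    ext i
    fin_cases i <;> simp [cross] <;> ring
  have h' := congrArg l h
  rw [map_smul, map_add, map_smul, map_smul, smul_eq_mul, smul_eq_mul, smul_eq_mul] at h'
  rw [mul_comm, ← abs_mul, h']
  refine (abs_add_le _ _).trans ?_
  rw [abs_mul, abs_mul, add_mul]
  have h1 := mul_le_mul_of_nonneg_right (abs_cross_le z v) (abs_nonneg (l u))
  have h2 := mul_le_mul_of_nonneg_right (abs_cross_le u z) (abs_nonneg (l v))
  linarith

theorem AffineIFS.IsAttractor.hasWideParts {κ : ℕ} {Φ : AffineIFS κ} {E : Set Plane}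
    (hE : Φ.IsAttractor E) (hdom : Φ.Dominated) {e : Direction}
    (he : lineOf e ∉ Φ.limitOrientations) (hcol : ¬ Collinear ℝ E) {n₀ : ℕ}
    (hproj : ∀ w : List (Fin κ), n₀ ≤ w.length →
      IsNontrivialInterval (projAlong e '' (Φ.wordMap w '' E))) :
    ∃ c > 0, ∃ ρ₀ > 0, HasWideParts E e c ρ₀ := by
  obtain ⟨c, hc, n₁, hn₁⟩ := Φ.exists_le_sinAngle_axis hdom he
  obtain ⟨κ₀, hκ₀, ρ₀, hρ₀, hcyl⟩ := hE.exists_cylinder (max n₀ n₁)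
  obtain ⟨p, hp, x, hx, y, hy, hxy⟩ := exists_cross_ne_zero_of_not_collinear hcol
  obtain ⟨D, hD0, hD⟩ : ∃ D, 0 < D ∧ ∀ x ∈ E, ∀ y ∈ E, dist x y ≤ D := by
    obtain ⟨D, hD⟩ := Metric.isBounded_iff.1 hE.1.isBounded
    exact ⟨max D 1, by positivity, fun x hx y hy => (hD hx hy).trans (le_max_left _ _)⟩
  set u := x - p with hu
  set v := y - p with hv
  have hu0 : 0 < ‖u‖ := norm_pos_iff.2 fun h => hxy (by simp [h, cross])
  set k := |cross u v| / (‖u‖ + ‖v‖) with hk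
  have hk0 : 0 < k := div_pos (abs_pos.2 hxy) (by positivity)
  refine ⟨k * c * κ₀ / D, by positivity, ρ₀ * D, by positivity, fun z hz ρ hρ hρle => ?_⟩
  obtain ⟨w, hw, hzw, hlow, hup⟩ := hcyl z hz (ρ / D) (by positivity) (by rwa [div_le_iff₀ hD0])
  set α := alpha₁ (Φ.wordLinear w) with hα
  have hα0 : 0 < α := AffineIFS.alpha₁_pos _
  refine ⟨Φ.wordMap w '' E, hE.wordMap_image_subset w, hzw, ?_,
    (hproj w (le_of_max_le_left hw)).cross_image.1, ?_⟩
  · rintro _ ⟨a, ha, rfl⟩ _ ⟨b, hb, rfl⟩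
    rw [dist_eq_norm, Φ.wordMap_sub]
    calc _ ≤ α * ‖a - b‖ := norm_map_le _ _
      _ ≤ ρ / D * D := by
        gcongr
        rw [← dist_eq_norm]
        exact hD a ha b hb
      _ = ρ := div_mul_cancel₀ _ hD0.ne'
  · let l : Plane →ₗ[ℝ] ℝ := crossₗ e ∘ₗ (Φ.wordLinear w).toLinearEquiv.toLinearMap
    have hl (a : Plane) : l a = cross e (Φ.wordLinear w a) := rfl
    have haxis : c * α ≤ |l (eta₁ (Φ.wordLinear w))| := by
      have h1 := hn₁ w (le_of_max_le_right hw)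
      rw [sinAngle, Φ.norm_axis, norm_direction, mul_one, le_div_iff₀ hα0, abs_cross_comm] at h1
      exact h1
    have h2 := abs_linear_mul_cross_le l u v (eta₁ (Φ.wordLinear w))
    rw [norm_eta₁, mul_one] at h2
    have h3 : k * c * κ₀ / D * ρ ≤ k * (c * α) := by
      calc k * c * κ₀ / D * ρ = k * c * (κ₀ * (ρ / D)) := by ring
        _ ≤ k * c * α := by gcongr
        _ = _ := by ring
    have h4 : k * (c * α) * (‖u‖ + ‖v‖) ≤ |l u| * ‖v‖ + |l v| * ‖u‖ := by
      refine le_trans ?_ h2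
      rw [hk, div_mul_eq_mul_div, div_mul_cancel₀ _ (by positivity), mul_comm]
      gcongr
    have hdiff (a : Plane) : cross e (Φ.wordMap w a) - cross e (Φ.wordMap w p) = l (a - p) := by
      rw [← cross_sub, Φ.wordMap_sub, hl]
    by_cases h5 : k * (c * α) ≤ |l u|
    · exact ⟨_, mem_image_of_mem _ hx, _, mem_image_of_mem _ hp, by rw [hdiff]; exact h3.trans h5⟩
    · refine ⟨_, mem_image_of_mem _ hy, _, mem_image_of_mem _ hp, ?_⟩
      rw [hdiff]
      refine h3.trans ?_
      by_contra! h6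
      have h7 : |l u| * ‖v‖ ≤ k * (c * α) * ‖v‖ := by
        gcongr
        exact (not_le.1 h5).le
      have h8 : |l v| * ‖u‖ < k * (c * α) * ‖u‖ := by gcongr
      linarith

end Visible

theorem theorem2p3 {κ : ℕ} (Φ : Visible.AffineIFS κ) (E : Set Visible.Plane)
    (hE : Φ.IsAttractor E) (hdom : Φ.Dominated) (hproj : Φ.ProjectionCondition E)
    (e : Visible.Direction) (he : Visible.lineOf e ∉ Φ.limitOrientations) :
    dimH (Visible.vis e E) = 1 ∧ Visible.assouadDim (Visible.vis e E) = 1 := by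
  obtain ⟨n₀, hn₀⟩ := hproj.2 e he
  have hbdd : Bornology.IsBounded (Visible.vis e E) := hE.1.isBounded.subset (Visible.vis_subset e E)
  have hlow : 1 ≤ dimH (Visible.vis e E) := by
    obtain ⟨x, hx⟩ := hE.2.1
    obtain ⟨w, hw, -⟩ : ∃ w : List (Fin κ), n₀ ≤ w.length ∧ x ∈ Φ.wordMap w '' E := by
      obtain ⟨κ₀, -, ρ₀, hρ₀, h⟩ := hE.exists_cylinder n₀
      obtain ⟨w, hw, hxw, -⟩ := h x hx ρ₀ hρ₀ le_rfl
      exact ⟨w, hw, hxw⟩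
    obtain ⟨hconv, hnt⟩ := (hn₀ w hw).cross_image
    exact Visible.dimH_vis_ge hE.1 (hE.wordMap_image_subset w) hconv hnt
  have hle := Visible.dimH_le_assouadDim hbdd
  have hup : Visible.assouadDim (Visible.vis e E) ≤ (1 : ℝ≥0) := by
    refine Visible.assouadDim_le_of_forall_lt fun s hs => ?_
    by_cases hcol : Collinear ℝ E
    · exact (Visible.AssouadExponent.of_collinear
        (hcol.subset (Visible.vis_subset e E))).mono hs.le
    · obtain ⟨c, hc, ρ₀, hρ₀, h⟩ := hE.hasWideParts hdom he hcol hn₀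
      exact Visible.assouadExponent_vis hE.1 hc hρ₀ h hs
  rw [ENNReal.coe_one] at hup
  exact ⟨le_antisymm (hle.trans hup) hlow, le_antisymm hup (hlow.trans hle)⟩
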